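/- Let $1<k<n$, $W=S_n$ with simple reflections $s_1,\dots,s_{n-1}$ and length function $\ell$, $W_K=\langle s_i: i\neq k\rangle$ with longest element $w_K$, and let $W^K_{\max}$ be the set of maximal-length representatives of the cosets $W_Kv$. *Lattice paths.* Work in a $k\times(n-k)$ rectangle. For a $k$-subset $I\subseteq[n]$ let $I^{\nearrow}$ be the lattice path from the southwest to the northeast corner whose $i$-th step is north if $i\in I$ and east otherwise, and let $I^{\swarrow}$ be the path from the northeast to the southwest corner whose $i$-th step is south if $i\in I$ and west otherwise. The Young diagram of a path consists of the boxes northwest of it. Let $D$ be the rectangle with $s_{k-r+c}$ in row $r$ and column $c$, and let $r(D)$ be $D$ rotated by $180^\circ$. For a box $b=(r,c)$ let $J(b)=\{1,\dots,k-r\}\cup\{k-r+c+1,\dots,k+c\}$, the set of north-step labels of the path bounding the $r\times c$ rectangle with lower right corner $b$. *Words.* Let $v\in W^K_{\max}$ and $w=xv$ with $\ell(w)=\ell(x)+\ell(v)$, and write $v=w_Kv'$. Read the boxes of a Young diagram column by column, from left to right, each column from top to bottom. A standard reduced expression for $w$ is $\mathbf w=\mathbf x\,\mathbf w_K\mathbf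 v'=s_{i_t}\cdots s_{i_1}$, where $\mathbf x$ consists of the entries of $D$ in the diagram of $x([k])^{\nearrow}$ in this order, written from right to left; $\mathbf v'$ consists of the entries of $D$ in the diagram of $(v'^{-1}([k]))^{\nearrow}$ in this order, written from left to right; and $\mathbf w_K$ is any reduced expression for $w_K$. Put $\mathbf w_{(j)}=s_{i_j}\cdots s_{i_1}$, let $\mathbf v$ be the positive distinguished (rightmost) subexpression for $v$ in $\mathbf w$, let $\mathbf v_{(j)}$ be its part inside $\mathbf w_{(j)}$, and let $J$ be the set of $j$ such that $s_{i_j}$ is not part of $\mathbf v$. For $j\in J$ the letter $s_{i_j}$ belongs to $\mathbf x$; let $b_j$ be the corresponding box of the diagram of $x([k])^{\nearrow}$. *Modules.* Let $\Lambda$ be the preprojective algebra of type $A_{n-1}$ over $\mathbb C$ (arrows $\alpha_i:i\to i+1$ and $\alpha_i^*:i+1\to i$, relation $\sum_i(\alpha_i\alpha_i^*-\alpha_i^*\alpha_i)=0$), with simple modules $S_i$ and indecomposable injective modules $Q_i$ with socle $S_i$. For a module $N$ let $\mathrm{Soc}_{s_i}(N)$ be the sum of all submodules isomorphic to $S_i$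 and $\mathcal E_i^\dagger(N)=N/\mathrm{Soc}_{s_i}(N)$. For a reduced word $z=s_{a_r}\cdots s_{a_1}$ let $\mathrm{Soc}_z(N)=N_r$, where $N_0=0$ and $N_p/N_{p-1}=\mathrm{Soc}_{s_{a_p}}(N/N_{p-1})$, and let $\mathcal E_z^\dagger=\mathcal E_{a_r}^\dagger\circ\cdots\circ\mathcal E_{a_1}^\dagger$. For $j\in J$ let $U_j=\mathcal E^\dagger_{\mathbf v_{(j)}^{-1}}\bigl(\mathrm{Soc}_{\mathbf w_{(j)}^{-1}}(Q_{i_j})\bigr)$, where the inverse of a word is the reversed word; these are the summands of Leclerc's cluster-tilting module. **Theorem.** Let $v\in W^K_{\max}$ and $w=xv$ with $\ell(w)=\ell(x)+\ell(v)$, let $\mathbf w$ be a standard reduced expression for $w$, let $j\in J$, and put $P_j=v^{-1}(J(b_j))$. Then $P_j^{\swarrow}$ lies weakly above (northwest of) $(v^{-1}([k]))^{\swarrow}$, and the region $R(P_j)$ of $r(D)$ between these two paths is the composition diagram of $U_j$. That is, $U_j$ has a $\mathbb C$-basis indexed by the boxes of $R(P_j)$ such that the basis vector of a box with entry $s_i$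 lies at vertex $i$; the arrow $i\to i+1$ sends it to the basis vector of the box immediately below, and the arrow $i\to i-1$ sends it to the basis vector of the box immediately to the right, each image being zero if that box is not in $R(P_j)$. -/

import Mathlib

/-! Conventions: everything is shifted to start from `0`.  The simple reflection `s_i`, the vertex `i`
of the quiver and the row/column `i` of a diagram (`i ≥ 1` in the usual numbering) have index `i - 1`;
the number `i ∈ [n]` is the element `i - 1` of `Fin n`. -/

namespace SkewSchubert

/-! ### The symmetric group `W = S_n` and words in the simple reflections -/

/-- The vertices `1, …, n-1` of the Dynkin diagram; they also index the simple reflections. -/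
abbrev Vtx (n : ℕ) := Fin (n - 1)

/-- The simple reflection exchanging two neighbours. -/
def s {n : ℕ} (i : Vtx n) : Equiv.Perm (Fin n) :=
  Equiv.swap ⟨i.1, by omega⟩ ⟨i.1 + 1, by omega⟩

/-- The Coxeter length of a permutation, i.e. its number of inversions. -/
def len {n : ℕ} (w : Equiv.Perm (Fin n)) : ℕ :=
  (Finset.univ.filter fun p : Fin n × Fin n => p.1 < p.2 ∧ w p.2 < w p.1).card

/-- The element of `S_n` spelled by a word.  A word `s_{i_t} ⋯ s_{i_1}` is the list
`[i_t, …, i_1]`, in the order in which it is written. -/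
def wordProd {n : ℕ} (z : List (Vtx n)) : Equiv.Perm (Fin n) := (z.map s).prod

def IsReducedWord {n : ℕ} (z : List (Vtx n)) (w : Equiv.Perm (Fin n)) : Prop :=
  wordProd z = w ∧ z.length = len w

/-- The parabolic subgroup `W_K = ⟨s_i : i ≠ k⟩`. -/
def WK (n k : ℕ) : Subgroup (Equiv.Perm (Fin n)) :=
  Subgroup.closure {g | ∃ i : Vtx n, i.1 + 1 ≠ k ∧ g = s i}

/-- `w` is the longest element `w_K` of `W_K`. -/
def IsLongestWK {n : ℕ} (k : ℕ) (w : Equiv.Perm (Fin n)) : Prop :=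
  w ∈ WK n k ∧ ∀ u ∈ WK n k, len u ≤ len w

/-- `W^K_max`: the maximal-length representatives of the cosets `W_K v`. -/
def WKmax (n k : ℕ) : Set (Equiv.Perm (Fin n)) :=
  {v | ∀ u ∈ WK n k, len (u * v) ≤ len v}

/-- The subset `[k]` of `[n]`. -/
def initial (n k : ℕ) : Finset (Fin n) := Finset.univ.filter fun i => i.1 < k

/-! ### Lattice paths and Young diagrams in the `k × (n-k)` rectangle -/

/-- Boxes of the rectangle, as (row, column), rows from top to bottom and columns from left to
right. -/
abbrev Box (n k : ℕ) := Fin k × Fin (n - k)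

/-- Number of vertical steps among the first `p` steps of the path whose vertical steps are
labelled by `I`. -/
def vert {n : ℕ} (I : Finset (Fin n)) (p : ℕ) : ℕ := (I.filter fun i => i.1 < p).card

/-- Number of horizontal steps among the first `p` steps of the path whose vertical steps are
labelled by `I`. -/
def hor {n : ℕ} (I : Finset (Fin n)) (p : ℕ) : ℕ := (Iᶜ.filter fun i => i.1 < p).card

/-- The Young diagram to the northwest of the path that runs from the southwest corner to the
northeast corner, with north steps labelled by `I` and east steps by the complement.
A box belongs to it iff the path visits, at some time `p`, a point weakly southeast of the southeast
corner of the box. -/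
def partNE {n : ℕ} (k : ℕ) (I : Finset (Fin n)) : Finset (Box n k) :=
  Finset.univ.filter fun b =>
    ∃ p : Fin (n + 1), vert I p + b.1.1 < k ∧ b.2.1 < hor I p

/-- The Young diagram to the northwest of the path that runs from the northeast corner to the
southwest corner, with south steps labelled by `I` and west steps by the complement. -/
def partSW {n : ℕ} (k : ℕ) (I : Finset (Fin n)) : Finset (Box n k) :=
  Finset.univ.filter fun b =>
    ∃ p : Fin (n + 1), b.1.1 < vert I p ∧ hor I p + b.2.1 < n - k

/-- The labels of the north steps of the northeast path bounding a Young diagram `μ`: the north step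
at the end of row `r` is preceded by one east step for each box of that row, and by the north
steps of the rows below. -/
def vertNE {n k : ℕ} (μ : Finset (Box n k)) : Finset (Fin n) :=
  Finset.univ.filter fun i =>
    ∃ r : Fin k, i.1 = (μ.filter fun b => b.1 = r).card + (k - 1 - r.1)

/-- `Rect(b)`: the largest rectangle with lower right corner `b`. -/
def rect {n k : ℕ} (b : Box n k) : Finset (Box n k) :=
  Finset.univ.filter fun q => q.1 ≤ b.1 ∧ q.2 ≤ b.2

/-- `J(b)`: the labels of the north steps of the path of `Rect(b)`. -/
def Jset {n k : ℕ} (b : Box n k) : Finset (Fin n) := vertNE (rect b)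

/-- The filling of the rectangle `D`: in the usual numbering the box in row `r`, column `c` carries
`s_{k-r+c}`. -/
def boxLabel {n k : ℕ} (b : Box n k) : Vtx n :=
  ⟨k - 1 - b.1.1 + b.2.1, by have h1 := b.1.2; have h2 := b.2.2; omega⟩

/-- The filling of `r(D)`, which is `D` rotated by 180 degrees. -/
def rotLabel {n k : ℕ} (b : Box n k) : Vtx n := boxLabel (n := n) (k := k) (b.1.rev, b.2.rev)

/-- The boxes of a diagram in the columnar reading order: columns from left to right, each
column from top to bottom. -/
def columnarBoxes {n k : ℕ} (μ : Finset (Box n k)) : List (Box n k) :=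
  (List.finRange (n - k)).flatMap fun c =>
    ((List.finRange k).map fun r => (r, c)).filter fun b => b ∈ μ

/-- The columnar expression of a minimal representative `x` of a coset `x W_K`: the fillings
of the boxes of the diagram of `x([k])`, read in columnar order and written from right to left. -/
def columnarWord {n : ℕ} (k : ℕ) (x : Equiv.Perm (Fin n)) : List (Vtx n) :=
  ((columnarBoxes (partNE k ((initial n k).image x))).map boxLabel).reverse

/-- The columnar expression of a minimal representative `y` of a coset `W_K y`: the fillings
of the boxes of the diagram of `y⁻¹([k])`, read in columnar order and written from left to right. -/
def columnarWord' {n : ℕ} (k : ℕ) (y : Equiv.Perm (Fin n)) : List (Vtx n) :=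
  (columnarBoxes (partNE k ((initial n k).image ⇑y⁻¹))).map boxLabel

/-- `ws` is a standard expression `𝐱 𝐰_K 𝐯'` of `x v`, where `v = w_K v'`: columnar expressions for
`x` and `v'`, and an arbitrary reduced expression for `w_K`.  (If `v ∈ W^K_max` and the factorization `x v` is
length-additive, then so is `v = w_K v'`, and `ws` is a reduced expression for `x v`.) -/
def IsStandardExpression {n : ℕ} (k : ℕ) (x v : Equiv.Perm (Fin n)) (ws : List (Vtx n)) : Prop :=
  ∃ (wK v' : Equiv.Perm (Fin n)) (ks : List (Vtx n)),
    IsLongestWK k wK ∧ v = wK * v' ∧ IsReducedWord ks wK ∧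
      ws = columnarWord k x ++ ks ++ columnarWord' k v'

/-! ### The positive distinguished subexpression -/

/-- The subword `𝐯_(j)` of the final part `𝐰_(j) = s_{i_j} ⋯ s_{i_1}` of a word that is selected by the
positive distinguished subexpression for `v`.  The letter `s_{i_j}` is taken iff
`v v_(j-1)⁻¹ s_{i_j} < v v_(j-1)⁻¹` in the Bruhat order, i.e. iff it decreases the length. -/
def pds {n : ℕ} (v : Equiv.Perm (Fin n)) : List (Vtx n) → List (Vtx n)
  | [] => []
  | i :: z =>
    if len (v * (wordProd (pds v z))⁻¹ * s i) < len (v * (wordProd (pds v z))⁻¹) then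
      i :: pds v z
    else pds v z

/-- The letter `i_j` of `s_{i_t} ⋯ s_{i_1}`; here `j : Fin t` is the usual index minus one. -/
def letter {n : ℕ} (ws : List (Vtx n)) (j : Fin ws.length) : Vtx n := ws.get j.rev

/-- The word `𝐰_(j) = s_{i_j} ⋯ s_{i_1}`. -/
def wPart {n : ℕ} (ws : List (Vtx n)) (j : Fin ws.length) : List (Vtx n) := ws.drop j.rev.1

/-- The word `𝐰_(j-1) = s_{i_{j-1}} ⋯ s_{i_1}`. -/
def wPartPred {n : ℕ} (ws : List (Vtx n)) (j : Fin ws.length) : List (Vtx n) :=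
  ws.drop (j.rev.1 + 1)

/-- `J`: the positions whose letter is not part of the positive distinguished subexpression. -/
def indexJ {n : ℕ} (v : Equiv.Perm (Fin n)) (ws : List (Vtx n)) : Set (Fin ws.length) :=
  {j | pds v (wPart ws j) = pds v (wPartPred ws j)}

/-! ### The preprojective algebra of type `A_{n-1}` -/

/-- The arrows `α_1, …, α_{n-2}` of the linearly oriented quiver. -/
abbrev Arr (n : ℕ) := Fin (n - 2)

/-- The source `i` of `α_i`. -/
def src {n : ℕ} (a : Arr n) : Vtx n := ⟨a.1, by omega⟩

/-- The target `i + 1` of `α_i`. -/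
def tgt {n : ℕ} (a : Arr n) : Vtx n := ⟨a.1 + 1, by omega⟩

/-- Generators of the path algebra of the double quiver: the trivial paths `e_i`, the arrows `α_i` and
the opposite arrows `α_i^*`. -/
inductive Gen (n : ℕ)
  | e (i : Vtx n)
  | al (a : Arr n)
  | als (a : Arr n)

open FreeAlgebra in
/-- The relations of the path algebra of the double quiver, followed by the preprojective relation.
Paths are composed from right to left, so that left modules are representations of the double quiver:
`α_i` acts as a map from the space at vertex `i` to the space at vertex `i + 1`. -/
inductive Rel (n : ℕ) : FreeAlgebra ℂ (Gen n) → FreeAlgebra ℂ (Gen n) → Prop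
  | idem (i : Vtx n) : Rel n (ι ℂ (Gen.e i) * ι ℂ (Gen.e i)) (ι ℂ (Gen.e i))
  | orth (i j : Vtx n) (h : i ≠ j) : Rel n (ι ℂ (Gen.e i) * ι ℂ (Gen.e j)) 0
  | one : Rel n (∑ i : Vtx n, ι ℂ (Gen.e i)) 1
  | al_tgt (a : Arr n) : Rel n (ι ℂ (Gen.e (tgt a)) * ι ℂ (Gen.al a)) (ι ℂ (Gen.al a))
  | al_src (a : Arr n) : Rel n (ι ℂ (Gen.al a) * ι ℂ (Gen.e (src a))) (ι ℂ (Gen.al a))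
  | als_tgt (a : Arr n) : Rel n (ι ℂ (Gen.e (src a)) * ι ℂ (Gen.als a)) (ι ℂ (Gen.als a))
  | als_src (a : Arr n) : Rel n (ι ℂ (Gen.als a) * ι ℂ (Gen.e (tgt a))) (ι ℂ (Gen.als a))
  | preproj : Rel n (∑ a : Arr n,
      (ι ℂ (Gen.al a) * ι ℂ (Gen.als a) - ι ℂ (Gen.als a) * ι ℂ (Gen.al a))) 0

/-- The preprojective algebra `Λ` over `ℂ` of type `A_{n-1}`. -/
abbrev Preproj (n : ℕ) := RingQuot (Rel n)

/-- The class in `Λ` of a generator. -/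
noncomputable def gen {n : ℕ} (g : Gen n) : Preproj n :=
  RingQuot.mkAlgHom ℂ (Rel n) (FreeAlgebra.ι ℂ g)

/-! ### Simple and injective modules, socles, and the functors `ℰ†` -/

/-- The algebra homomorphism `Λ → ℂ` sending `e_i` to `1` and all other generators to `0`. -/
noncomputable def simpleChar {n : ℕ} (i : Vtx n) : Preproj n →ₐ[ℂ] ℂ :=
  RingQuot.liftAlgHom ℂ ⟨FreeAlgebra.lift ℂ fun g : Gen n =>
      match g with
      | Gen.e j => if j = i then (1 : ℂ) else 0
      | Gen.al _ => 0
      | Gen.als _ => 0, by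
    intro x y h
    induction h with
    | orth j l h =>
      by_cases hj : j = i
      · subst hj; simp [Ne.symm h]
      · simp [hj]
    | _ => simp⟩

/-- The simple module `S_i`: the vector space `ℂ` at vertex `i`, zero elsewhere. -/
def SimpleMod {n : ℕ} (_ : Vtx n) : Type := ℂ

noncomputable instance {n : ℕ} (i : Vtx n) : AddCommGroup (SimpleMod i) :=
  inferInstanceAs (AddCommGroup ℂ)

noncomputable instance {n : ℕ} (i : Vtx n) : Module (Preproj n) (SimpleMod i) :=
  Module.compHom ℂ (simpleChar i).toRingHom

/-- The right ideal `e_i Λ`, spanned by the paths that end at `i`. -/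
noncomputable def rightIdeal {n : ℕ} (i : Vtx n) : Submodule ℂ (Preproj n) :=
  LinearMap.range (LinearMap.mulLeft ℂ (gen (Gen.e i)))

/-- Right multiplication by an element of `Λ` on `e_i Λ`. -/
noncomputable def rmul {n : ℕ} (i : Vtx n) (a : Preproj n) : rightIdeal i →ₗ[ℂ] rightIdeal i :=
  (LinearMap.mulRight ℂ a).restrict (by
    rintro _ ⟨y, rfl⟩
    exact ⟨y * a, by simp [mul_assoc]⟩)

/-- The indecomposable injective `Λ`-module `Q_i` with socle `S_i`: the `ℂ`-dual of the right
module `e_i Λ`, with `(a • f) x = f (x a)`. -/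
def InjMod {n : ℕ} (i : Vtx n) : Type := rightIdeal i →ₗ[ℂ] ℂ

noncomputable instance {n : ℕ} (i : Vtx n) : AddCommGroup (InjMod i) :=
  inferInstanceAs (AddCommGroup (rightIdeal i →ₗ[ℂ] ℂ))

noncomputable instance {n : ℕ} (i : Vtx n) : Module (Preproj n) (InjMod i) where
  smul a f := LinearMap.comp (show rightIdeal i →ₗ[ℂ] ℂ from f) (rmul i a)
  one_smul f := LinearMap.ext fun x => congrArg (show rightIdeal i →ₗ[ℂ] ℂ from f)
    (Subtype.ext (mul_one x.1))
  mul_smul a b f := LinearMap.ext fun x => congrArg (show rightIdeal i →ₗ[ℂ] ℂ from f)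
    (Subtype.ext (mul_assoc x.1 a b).symm)
  smul_zero _ := LinearMap.ext fun _ => rfl
  smul_add _ _ _ := LinearMap.ext fun _ => rfl
  add_smul a b f := LinearMap.ext fun x => by
    have h : rmul i (a + b) x = rmul i a x + rmul i b x := Subtype.ext (mul_add x.1 a b)
    exact (congrArg (show rightIdeal i →ₗ[ℂ] ℂ from f) h).trans (map_add _ _ _)
  zero_smul f := LinearMap.ext fun x => by
    have h : rmul i (0 : Preproj n) x = 0 := Subtype.ext (mul_zero x.1)
    exact (congrArg (show rightIdeal i →ₗ[ℂ] ℂ from f) h).trans (map_zero _)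

/-- `Soc_{s_i}(N)`: the sum of all submodules of `N` isomorphic to `S_i`. -/
noncomputable def soc {n : ℕ} (i : Vtx n) (N : Type) [AddCommGroup N] [Module (Preproj n) N] :
    Submodule (Preproj n) N :=
  isotypicComponent (Preproj n) N (SimpleMod i)

/-- `Soc_z(N)` for a word `z = s_{i_r} ⋯ s_{i_1}`: the last term of the chain
`0 = N_0 ⊆ N_1 ⊆ ⋯ ⊆ N_r` with `N_p / N_{p-1} = Soc_{s_{i_p}}(N / N_{p-1})`. -/
noncomputable def socWord {n : ℕ} (N : Type) [AddCommGroup N] [Module (Preproj n) N] :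
    List (Vtx n) → Submodule (Preproj n) N
  | [] => ⊥
  | i :: z => (soc i (N ⧸ socWord N z)).comap (socWord N z).mkQ

/-- `ℰ†_i(N)`: the cokernel of the inclusion of the `S_i`-isotypical part of the socle of `N`. -/
noncomputable def Edag {n : ℕ} (i : Vtx n) (N : ModuleCat.{0} (Preproj n)) :
    ModuleCat.{0} (Preproj n) :=
  ModuleCat.of (Preproj n) (N ⧸ soc i N)

/-- `ℰ†_z = ℰ†_{i_r} ∘ ⋯ ∘ ℰ†_{i_1}` for a word `z = s_{i_r} ⋯ s_{i_1}`. -/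
noncomputable def EdagWord {n : ℕ} (z : List (Vtx n)) (N : ModuleCat.{0} (Preproj n)) :
    ModuleCat.{0} (Preproj n) :=
  z.foldr Edag N

/-- `V_j = Soc_{w_(j)⁻¹}(Q_{i_j})`. -/
noncomputable def moduleV {n : ℕ} (ws : List (Vtx n)) (j : Fin ws.length) :
    ModuleCat.{0} (Preproj n) :=
  ModuleCat.of (Preproj n) (socWord (InjMod (letter ws j)) (wPart ws j).reverse)

/-- `U_j = ℰ†_{v_(j)⁻¹}(V_j)`. -/
noncomputable def moduleU {n : ℕ} (v : Equiv.Perm (Fin n)) (ws : List (Vtx n))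
    (j : Fin ws.length) : ModuleCat.{0} (Preproj n) :=
  EdagWord (pds v (wPart ws j)).reverse (moduleV ws j)

/-! ### Composition diagrams -/

/-- `R(P)`: the region of `r(D)` between the southwest paths of `P` (above) and `L` (below). -/
def region {n : ℕ} (k : ℕ) (P L : Finset (Fin n)) : Finset (Box n k) := partSW k L \ partSW k P

/-- `b'` is immediately below `b`. -/
def Below {n k : ℕ} (b b' : Box n k) : Prop := b'.1.1 = b.1.1 + 1 ∧ b'.2 = b.2

/-- `b'` is immediately to the right of `b`. -/
def RightOf {n k : ℕ} (b b' : Box n k) : Prop := b'.1 = b.1 ∧ b'.2.1 = b.2.1 + 1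

/-- The region `R` of `r(D)` is a composition diagram of the `Λ`-module `N`: `N` has a `ℂ`-basis indexed by
the boxes of `R`, the basis vector of a box with label `i` lies at vertex `i`, the arrow `i → i + 1`
sends it to the basis vector of the box immediately below, the arrow `i → i - 1` sends it to the basis
vector of the box immediately to the right, and these images are zero if that box is not in `R`.
(In `r(D)` labels increase by one downwards and decrease by one to the right.) -/
def HasCompositionDiagram {n k : ℕ} (N : ModuleCat.{0} (Preproj n)) (R : Finset (Box n k)) : Prop :=
  letI : Module ℂ N := Module.compHom N (algebraMap ℂ (Preproj n))
  ∃ B : Module.Basis R ℂ N,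
    (∀ (i : Vtx n) (b : R), gen (Gen.e i) • B b = if rotLabel b.1 = i then B b else 0) ∧
    (∀ (a : Arr n) (b b' : R), src a = rotLabel b.1 → Below b.1 b'.1 →
      gen (Gen.al a) • B b = B b') ∧
    (∀ (a : Arr n) (b : R), src a = rotLabel b.1 → (∀ b' : R, ¬ Below b.1 b'.1) →
      gen (Gen.al a) • B b = 0) ∧
    (∀ (a : Arr n) (b b' : R), tgt a = rotLabel b.1 → RightOf b.1 b'.1 →
      gen (Gen.als a) • B b = B b') ∧
    (∀ (a : Arr n) (b : R), tgt a = rotLabel b.1 → (∀ b' : R, ¬ RightOf b.1 b'.1) →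
      gen (Gen.als a) • B b = 0)

end SkewSchubert

open SkewSchubert

namespace SkewSchubert

/-! ### Generation of the preprojective algebra and the characterisation of socles -/

/-! All modules involved are subquotients of an injective `Q_l` whose composition diagram is a
rectangle with one-dimensional pieces, so every socle operation only removes boxes. The proof
reduces the theorem to the combinatorics of lattice paths.

Algebra. Let `A` be the sum of the arrows `α` and `A*` that of the `α*`. The preprojective relation
says that `A` and `A*` commute, so `e_l Λ` is spanned by the paths `e_l A^p A*^q`. An explicit
representation on functions on a rectangle shows that those with indices in the rectangle are
independent. The dual coordinates make `Q_l` a module with a diagram (`injCoord`). In such a module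
the `S_i`-socle is spanned by the boxes at vertex `i` without successors, so `Soc_z` and `ℰ†_z` just
delete or keep boxes (`mem_socWord_iff`, `nonempty_edagWord`).

Paths. A diagram between two lattice paths is recorded by two height functions. Removing the
`S_i`-socle lowers the upper one at a single place, if it has a peak there
(`heightRegion_diff_socBoxes`). Along a reduced word `z` this turns the path of `[l]` into that of
`z⁻¹[l]` (`greedyWord_vert_initial`). For `j ∈ J` the word `𝐰_(j)` is an initial part of the diagram
of `x`, followed by the full word of `v`, and its distinguished subexpression is that word of `v`.
Hence the diagram of `U_j` lies between the paths of `v⁻¹[l]` and `𝐰_(j)⁻¹[l] = v⁻¹(A(b))`, where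
`A(b) = {1, …, k-r} ∪ {k+1, …, k+c}` for `b = (r, c)` and `l = k-r+c` (`truncated_inv_image`).

Comparison. As multisets `[l] + J(b) = [k] + A(b)`, so on every diagonal this region has as many
boxes as the one between the paths of `v⁻¹[k]` and `v⁻¹(J(b))` (`vert_sum_eq`). The two regions
differ by a shift along each diagonal. The shift can change only at a step where `v` takes a value
in exactly one of `[l]` and `[k]`. Since `v⁻¹` is decreasing on each of the two blocks of `W_K`, the
diagonal there is empty (`vert_le_of_step_ne`), so the shift preserves adjacency. -/

theorem gen_relation {n : ℕ} {a b : FreeAlgebra ℂ (Gen n)} (h : Rel n a b) :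
    RingQuot.mkAlgHom ℂ (Rel n) a = RingQuot.mkAlgHom ℂ (Rel n) b :=
  RingQuot.mkAlgHom_rel ℂ h

theorem preproj_induction {n : ℕ} {motive : Preproj n → Prop}
    (hscalar : ∀ c : ℂ, motive (algebraMap ℂ (Preproj n) c))
    (hgen : ∀ g : Gen n, motive (gen g))
    (hmul : ∀ a b, motive a → motive b → motive (a * b))
    (hadd : ∀ a b, motive a → motive b → motive (a + b)) (a : Preproj n) : motive a := by
  obtain ⟨y, rfl⟩ := RingQuot.mkAlgHom_surjective ℂ (Rel n) a
  induction y using FreeAlgebra.induction with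
  | grade0 c => simpa using hscalar c
  | grade1 g => exact hgen g
  | mul a b ha hb => rw [map_mul]; exact hmul _ _ ha hb
  | add a b ha hb => rw [map_add]; exact hadd _ _ ha hb

theorem gen_e_idem {n : ℕ} (i : Vtx n) :
    (gen (Gen.e i) : Preproj n) * gen (Gen.e i) = gen (Gen.e i) := by
  simpa [gen] using gen_relation (Rel.idem i)

theorem gen_e_orth {n : ℕ} {i j : Vtx n} (h : i ≠ j) :
    (gen (Gen.e i) : Preproj n) * gen (Gen.e j) = 0 := by
  simpa [gen] using gen_relation (Rel.orth i j h)

theorem gen_tgt_mul_al {n : ℕ} (a : Arr n) :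
    (gen (Gen.e (tgt a)) : Preproj n) * gen (Gen.al a) = gen (Gen.al a) := by
  simpa [gen] using gen_relation (Rel.al_tgt a)

theorem gen_al_mul_src {n : ℕ} (a : Arr n) :
    (gen (Gen.al a) : Preproj n) * gen (Gen.e (src a)) = gen (Gen.al a) := by
  simpa [gen] using gen_relation (Rel.al_src a)

theorem gen_src_mul_als {n : ℕ} (a : Arr n) :
    (gen (Gen.e (src a)) : Preproj n) * gen (Gen.als a) = gen (Gen.als a) := by
  simpa [gen] using gen_relation (Rel.als_tgt a)

theorem gen_als_mul_tgt {n : ℕ} (a : Arr n) :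
    (gen (Gen.als a) : Preproj n) * gen (Gen.e (tgt a)) = gen (Gen.als a) := by
  simpa [gen] using gen_relation (Rel.als_src a)

theorem sum_gen_preproj (n : ℕ) : ∑ a : Arr n,
    ((gen (Gen.al a) : Preproj n) * gen (Gen.als a) - gen (Gen.als a) * gen (Gen.al a)) = 0 := by
  simpa [gen] using gen_relation (Rel.preproj (n := n))

theorem simpleChar_gen {n : ℕ} (i : Vtx n) (g : Gen n) :
    simpleChar i (gen g) = match g with
      | Gen.e j => if j = i then (1 : ℂ) else 0
      | Gen.al _ => 0
      | Gen.als _ => 0 := by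
  cases g <;>
    simp only [simpleChar, gen, RingQuot.liftAlgHom_mkAlgHom_apply, FreeAlgebra.lift_ι_apply]

/-- The elements on which `Λ` acts through the character of `S_i`. -/
noncomputable def charSubmodule {n : ℕ} (i : Vtx n) (N : Type) [AddCommGroup N]
    [Module (Preproj n) N] : Submodule (Preproj n) N where
  carrier := {m | ∀ a : Preproj n, a • m = algebraMap ℂ (Preproj n) (simpleChar i a) • m}
  add_mem' h1 h2 a := by rw [smul_add, smul_add, h1 a, h2 a]
  zero_mem' a := by simp
  smul_mem' b m hm a := by
    rw [hm b, ← mul_smul, ← Algebra.commutes, mul_smul, hm a, ← mul_smul, ← mul_smul,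
      Algebra.commutes]

/-- A nonzero vector on which `Λ` acts through the character spans a copy of `S_i`. Conversely, the
character acts on any copy of `S_i`, and the vectors with this property form a submodule. -/
theorem soc_eq_charSubmodule {n : ℕ} (i : Vtx n) (N : Type) [AddCommGroup N]
    [Module (Preproj n) N] : soc i N = charSubmodule i N := by
  apply le_antisymm
  · refine sSup_le ?_
    rintro P ⟨f⟩ m hm a
    have key : ∀ y : SimpleMod i, a • y = algebraMap ℂ (Preproj n) (simpleChar i a) • y := by
      intro y
      change simpleChar i a * (show ℂ from y) =
        simpleChar i (algebraMap ℂ (Preproj n) (simpleChar i a)) * (show ℂ from y)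
      simp
    have h := f.injective ((f.map_smul a ⟨m, hm⟩).trans ((key _).trans (f.map_smul _ ⟨m, hm⟩).symm))
    exact congrArg Subtype.val h
  · intro m hm
    by_cases h0 : m = 0
    · rw [h0]; exact zero_mem _
    let f : SimpleMod i →ₗ[Preproj n] N :=
      { toFun := fun c => algebraMap ℂ (Preproj n) (show ℂ from c) • m
        map_add' := fun c d => by
          rw [← add_smul, ← map_add]; rfl
        map_smul' := fun a c => by
          change algebraMap ℂ (Preproj n) (simpleChar i a * (show ℂ from c)) • m =
            a • (algebraMap ℂ (Preproj n) (show ℂ from c) • m)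
          rw [← mul_smul, ← Algebra.commutes, mul_smul, hm a, ← mul_smul, ← map_mul, mul_comm] }
    have hf : Function.Injective f := by
      rw [← LinearMap.ker_eq_bot, LinearMap.ker_eq_bot']
      intro c hc
      change algebraMap ℂ (Preproj n) (show ℂ from c) • m = 0 at hc
      by_contra hne
      apply h0
      have : algebraMap ℂ (Preproj n) ((show ℂ from c)⁻¹ * (show ℂ from c)) • m = 0 := by
        rw [map_mul, mul_smul, hc, smul_zero]
      rw [inv_mul_cancel₀ (show (show ℂ from c) ≠ 0 from hne), map_one, one_smul] at this
      exact this
    have hle : LinearMap.range f ≤ soc i N :=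
      le_sSup ⟨(LinearEquiv.ofInjective f hf).symm⟩
    refine hle ⟨(show SimpleMod i from (1 : ℂ)), ?_⟩
    change algebraMap ℂ (Preproj n) (1 : ℂ) • m = m
    rw [map_one, one_smul]

/-- Acting through a character can be tested on generators. The idempotents `e_j` with `j ≠ i` need
no separate condition, being orthogonal to `e_i`. -/
theorem mem_soc_iff {n : ℕ} {i : Vtx n} {N : Type} [AddCommGroup N] [Module (Preproj n) N]
    {m : N} : m ∈ soc i N ↔ (gen (Gen.e i) : Preproj n) • m = m ∧
      (∀ a : Arr n, (gen (Gen.al a) : Preproj n) • m = 0) ∧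
      (∀ a : Arr n, (gen (Gen.als a) : Preproj n) • m = 0) := by
  rw [soc_eq_charSubmodule]
  constructor
  · intro hm
    refine ⟨?_, fun a => ?_, fun a => ?_⟩
    · simpa [simpleChar_gen] using hm (gen (Gen.e i))
    · simpa [simpleChar_gen] using hm (gen (Gen.al a))
    · simpa [simpleChar_gen] using hm (gen (Gen.als a))
  · rintro ⟨he, hal, hals⟩ a
    induction a using preproj_induction with
    | hscalar c => simp
    | hgen g =>
      rw [simpleChar_gen]
      cases g with
      | e j =>
        by_cases h : j = i
        · subst h; simp [he]
        · rw [← he, ← mul_smul, gen_e_orth h]; simp [h]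
      | al a => simp [hal]
      | als a => simp [hals]
    | hmul a b ha hb =>
      rw [mul_smul, hb, ← mul_smul, ← Algebra.commutes, mul_smul, ha, ← mul_smul, ← map_mul,
        map_mul (simpleChar i), mul_comm]
    | hadd a b ha hb => rw [add_smul, ha, hb, ← add_smul, ← map_add, map_add (simpleChar i)]

/-! ### Coordinates on modules with a diagram -/

/-- The points of `R` at `i` from which neither the point below nor the point to the right is in
`R`.  The point below `(l, r)` is `(l + 1, r + 1)`, the point to its right is `(l - 1, r)`. -/
def socBoxes (i : ℕ) (R : Set (ℕ × ℕ)) : Set (ℕ × ℕ) :=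
  {b | b ∈ R ∧ b.1 = i ∧ (b.1 + 1, b.2 + 1) ∉ R ∧ ∀ l, l + 1 = b.1 → (l, b.2) ∉ R}

/-- What remains of `R` after successively removing the socle boxes of the letters of a word, the
last letter first. -/
def remaining {n : ℕ} (R : Set (ℕ × ℕ)) : List (Vtx n) → Set (ℕ × ℕ)
  | [] => R
  | i :: z => remaining R z \ socBoxes i.1 (remaining R z)

/-- Coordinates on a module `N` with composition diagram `R`; the point `(l, r)` lies at the
vertex `l`. -/
structure DiagramCoord {n : ℕ} (N : Type) [AddCommGroup N] [Module (Preproj n) N]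
    (R : Set (ℕ × ℕ)) where
  coord : N →+ (ℕ × ℕ → ℂ)
  vertex_lt : ∀ b ∈ R, b.1 + 1 < n
  coord_smul : ∀ (c : ℂ) (m : N), coord (algebraMap ℂ (Preproj n) c • m) = c • coord m
  injective : Function.Injective coord
  support : ∀ m, ∀ b, b ∉ R → coord m b = 0
  exists_of_support : ∀ f : ℕ × ℕ → ℂ, (∀ b, b ∉ R → f b = 0) → ∃ m, coord m = f
  coord_e : ∀ (i : Vtx n) (m : N) (b : ℕ × ℕ),
    coord ((gen (Gen.e i) : Preproj n) • m) b = if b.1 = i.1 then coord m b else 0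
  coord_al : ∀ (a : Arr n) (m : N) (l r : ℕ), (l + 1, r + 1) ∈ R →
    coord ((gen (Gen.al a) : Preproj n) • m) (l + 1, r + 1) = if l = a.1 then coord m (l, r) else 0
  -- A point with a zero coordinate has no predecessor along an arrow `α`, and is not of the form
  -- covered by the previous field.
  coord_al_zero : ∀ (a : Arr n) (m : N) (b : ℕ × ℕ), (b.1 = 0 ∨ b.2 = 0) →
    coord ((gen (Gen.al a) : Preproj n) • m) b = 0
  coord_als : ∀ (a : Arr n) (m : N) (l r : ℕ), (l, r) ∈ R →
    coord ((gen (Gen.als a) : Preproj n) • m) (l, r) = if l = a.1 then coord m (l + 1, r) else 0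

theorem remaining_subset {n : ℕ} (R : Set (ℕ × ℕ)) (z : List (Vtx n)) : remaining R z ⊆ R := by
  induction z with
  | nil => exact subset_rfl
  | cons i z ih => exact Set.sdiff_subset.trans ih

/-- A box with a surviving successor is never a socle box. This and the next lemma show that what
remains is closed under predecessors, so vanishing on it is a condition stable under `Λ`. -/
theorem below_mem_remaining {n : ℕ} {R : Set (ℕ × ℕ)} (z : List (Vtx n)) {l r : ℕ}
    (h : (l, r) ∈ R) (h' : (l + 1, r + 1) ∈ remaining R z) : (l, r) ∈ remaining R z := by
  induction z with
  | nil => exact h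
  | cons i z ih => exact ⟨ih h'.1, fun hs => hs.2.2.1 h'.1⟩

theorem right_mem_remaining {n : ℕ} {R : Set (ℕ × ℕ)} (z : List (Vtx n)) {l r : ℕ}
    (h : (l + 1, r) ∈ R) (h' : (l, r) ∈ remaining R z) : (l + 1, r) ∈ remaining R z := by
  induction z with
  | nil => exact h
  | cons i z ih => exact ⟨ih h'.1, fun hs => hs.2.2.2 l rfl h'.1⟩

namespace DiagramCoord

variable {n : ℕ} {N : Type} [AddCommGroup N] [Module (Preproj n) N] {R : Set (ℕ × ℕ)}

/-- When an element lies in the `S_i`-socle modulo the elements whose coordinates vanish on a subset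
`R'` that is closed under predecessors. -/
theorem arrows_vanish_iff (C : DiagramCoord (n := n) N R) {R' : Set (ℕ × ℕ)} (hR' : R' ⊆ R)
    (hbelow : ∀ l r, (l, r) ∈ R → (l + 1, r + 1) ∈ R' → (l, r) ∈ R')
    (hright : ∀ l r, (l + 1, r) ∈ R → (l, r) ∈ R' → (l + 1, r) ∈ R') (i : Vtx n) (m : N) :
    ((∀ b ∈ R', C.coord ((gen (Gen.e i) : Preproj n) • m - m) b = 0) ∧
      (∀ a : Arr n, ∀ b ∈ R', C.coord ((gen (Gen.al a) : Preproj n) • m) b = 0) ∧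
      (∀ a : Arr n, ∀ b ∈ R', C.coord ((gen (Gen.als a) : Preproj n) • m) b = 0)) ↔
    ∀ b ∈ R' \ socBoxes i.1 R', C.coord m b = 0 := by
  constructor
  · rintro ⟨h1, h2, h3⟩ ⟨l, r⟩ ⟨hb, hs⟩
    by_cases hl : l = i.1
    swap
    · have := h1 _ hb
      simpa [C.coord_e, hl] using this
    -- A point of `R'` on the diagonal `i` that is not a socle box has a successor in `R'`, and the
    -- arrow leading there carries the coordinate along unchanged.
    by_cases hd : (l + 1, r + 1) ∈ R'
    · have hn := C.vertex_lt _ (hR' hd)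
      have := h2 ⟨l, by simp at hn; omega⟩ _ hd
      rw [C.coord_al _ _ _ _ (hR' hd)] at this
      simpa using this
    by_cases hr : ∃ l', l' + 1 = l ∧ (l', r) ∈ R'
    · obtain ⟨l', rfl, hr⟩ := hr
      have hn := C.vertex_lt _ (hR' hb)
      have := h3 ⟨l', by simp at hn; omega⟩ _ hr
      rw [C.coord_als _ _ _ _ (hR' hr)] at this
      simpa using this
    · push Not at hr
      exact absurd ⟨hb, hl, hd, hr⟩ hs
  · intro h
    refine ⟨?_, ?_, ?_⟩
    · intro b hb
      by_cases hl : b.1 = i.1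
      · simp [C.coord_e, hl]
      · simp only [map_sub, Pi.sub_apply, C.coord_e, hl, if_false, zero_sub, neg_eq_zero]
        exact h b ⟨hb, fun hs => hl hs.2.1⟩
    · rintro a ⟨l, r⟩ hb
      rcases l with _ | l
      · exact C.coord_al_zero _ _ _ (Or.inl rfl)
      rcases r with _ | r
      · exact C.coord_al_zero _ _ _ (Or.inr rfl)
      rw [C.coord_al _ _ _ _ (hR' hb)]
      split_ifs with hla
      · by_cases hR : (l, r) ∈ R
        · exact h _ ⟨hbelow _ _ hR hb, fun hs => hs.2.2.1 hb⟩
        · exact C.support _ _ hR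
      · rfl
    · rintro a ⟨l, r⟩ hb
      rw [C.coord_als _ _ _ _ (hR' hb)]
      split_ifs with hla
      · by_cases hR : (l + 1, r) ∈ R
        · exact h _ ⟨hright _ _ hR hb, fun hs => hs.2.2.2 l rfl hb⟩
        · exact C.support _ _ hR
      · rfl

theorem mem_soc_iff_coord (C : DiagramCoord (n := n) N R) (i : Vtx n) (m : N) :
    m ∈ soc i N ↔ ∀ b ∈ R \ socBoxes i.1 R, C.coord m b = 0 := by
  rw [← C.arrows_vanish_iff subset_rfl (fun _ _ h _ => h) (fun _ _ h _ => h), mem_soc_iff]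
  have key : ∀ y : N, (∀ b ∈ R, C.coord y b = 0) ↔ y = 0 := by
    intro y
    constructor
    · intro h
      apply C.injective
      rw [map_zero]
      funext b
      by_cases hb : b ∈ R
      · exact h b hb
      · exact C.support _ _ hb
    · rintro rfl; simp
  simp only [key, sub_eq_zero]

/-- Induction on the word: by the inductive hypothesis, being zero in the quotient means vanishing
on the remaining boxes, so the socle of the quotient is described by `arrows_vanish_iff`. -/
theorem mem_socWord_iff (C : DiagramCoord (n := n) N R) (z : List (Vtx n)) (m : N) :
    m ∈ socWord N z ↔ ∀ b ∈ remaining R z, C.coord m b = 0 := by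
  induction z generalizing m with
  | nil =>
    simp only [socWord, remaining, Submodule.mem_bot]
    constructor
    · rintro rfl; simp
    · intro h
      apply C.injective
      rw [map_zero]
      funext b
      by_cases hb : b ∈ R
      · exact h b hb
      · exact C.support _ _ hb
  | cons i z ih =>
    simp only [socWord, remaining, Submodule.mem_comap]
    rw [← C.arrows_vanish_iff (remaining_subset R z) (fun _ _ => below_mem_remaining z)
      (fun _ _ => right_mem_remaining z), mem_soc_iff]
    simp only [← ih, Submodule.mkQ_apply, ← Submodule.Quotient.mk_smul,
      Submodule.Quotient.mk_eq_zero, Submodule.Quotient.eq]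

open Classical in
/-- The coordinates on `N / Soc_i(N)`. -/
noncomputable def quotientSoc (C : DiagramCoord (n := n) N R) (i : Vtx n) :
    DiagramCoord (n := n) (N ⧸ soc i N) (R \ socBoxes i.1 R) := by
  let R' := R \ socBoxes i.1 R
  let f : N →+ (ℕ × ℕ → ℂ) :=
    { toFun := fun m b => if b ∈ R' then C.coord m b else 0
      map_zero' := by funext b; simp
      map_add' := fun x y => by funext b; by_cases hb : b ∈ R' <;> simp [hb] }
  have hf : ∀ m, f m = 0 ↔ m ∈ soc i N := by
    intro m
    rw [C.mem_soc_iff_coord]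
    constructor
    · intro h b hb
      have h1 : (if b ∈ R' then C.coord m b else 0) = 0 := congrFun h b
      rwa [if_pos hb] at h1
    · intro h
      funext b
      by_cases hb : b ∈ R'
      · simpa [f, hb] using h b hb
      · simp [f, hb]
  let F : N ⧸ soc i N →+ (ℕ × ℕ → ℂ) := QuotientAddGroup.lift (soc i N).toAddSubgroup f
    fun m hm => AddMonoidHom.mem_ker.2 ((hf m).2 hm)
  refine
    { coord := F
      vertex_lt := fun b hb => C.vertex_lt b hb.1
      coord_smul := ?_
      injective := ?_
      support := ?_
      exists_of_support := ?_
      coord_e := ?_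
      coord_al := ?_
      coord_al_zero := ?_
      coord_als := ?_ }
  · intro c m
    obtain ⟨m, rfl⟩ := (soc i N).mkQ_surjective m
    change f (algebraMap ℂ (Preproj n) c • m) = c • f m
    funext b
    by_cases hb : b ∈ R' <;> simp [f, hb, C.coord_smul]
  · rw [injective_iff_map_eq_zero]
    intro m
    obtain ⟨m, rfl⟩ := (soc i N).mkQ_surjective m
    intro h
    exact (Submodule.Quotient.mk_eq_zero _).2 ((hf m).1 h)
  · intro m b hb
    obtain ⟨m, rfl⟩ := (soc i N).mkQ_surjective m
    change f m b = 0
    exact if_neg hb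
  · intro g hg
    obtain ⟨m, hm⟩ := C.exists_of_support g fun b hb => hg b fun h => hb h.1
    refine ⟨(soc i N).mkQ m, ?_⟩
    change f m = g
    funext b
    by_cases hb : b ∈ R'
    · simp [f, hb, hm]
    · simp [f, hb, hg b hb]
  · intro j m b
    obtain ⟨m, rfl⟩ := (soc i N).mkQ_surjective m
    change f ((gen (Gen.e j) : Preproj n) • m) b = if b.1 = j.1 then f m b else 0
    by_cases hb : b ∈ R' <;> simp [f, hb, C.coord_e]
  · intro a m l r hb
    obtain ⟨m, rfl⟩ := (soc i N).mkQ_surjective m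
    change f ((gen (Gen.al a) : Preproj n) • m) (l + 1, r + 1) = if l = a.1 then f m (l, r) else 0
    have hb' : (l + 1, r + 1) ∈ R' := hb
    simp only [f, AddMonoidHom.coe_mk, ZeroHom.coe_mk, hb', if_true, C.coord_al _ _ _ _ hb'.1]
    -- A predecessor of a surviving box is not a socle box, so the truncation has not erased the
    -- coordinate that the arrow transports.
    split_ifs with h1 h2
    · rfl
    · by_contra hne
      have hR : (l, r) ∈ R := by by_contra h; exact hne (C.support _ _ h)
      exact h2 ⟨hR, fun hs => hs.2.2.1 hb'.1⟩
    · rfl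
  · intro a m b hb
    obtain ⟨m, rfl⟩ := (soc i N).mkQ_surjective m
    change f ((gen (Gen.al a) : Preproj n) • m) b = 0
    simp [f, C.coord_al_zero a m b hb]
  · intro a m l r hb
    obtain ⟨m, rfl⟩ := (soc i N).mkQ_surjective m
    change f ((gen (Gen.als a) : Preproj n) • m) (l, r) = if l = a.1 then f m (l + 1, r) else 0
    have hb' : (l, r) ∈ R' := hb
    simp only [f, AddMonoidHom.coe_mk, ZeroHom.coe_mk, hb', if_true, C.coord_als _ _ _ _ hb'.1]
    split_ifs with h1 h2
    · rfl
    · by_contra hne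
      have hR : (l + 1, r) ∈ R := by by_contra h; exact hne (C.support _ _ h)
      exact h2 ⟨hR, fun hs => hs.2.2.2 l rfl hb'.1⟩
    · rfl

/-- The coordinates on `Soc_z(N)`. -/
noncomputable def ofSocWord (C : DiagramCoord (n := n) N R) (z : List (Vtx n)) :
    DiagramCoord (n := n) (socWord N z) (R \ remaining R z) where
  coord := C.coord.comp (socWord N z).subtype.toAddMonoidHom
  vertex_lt b hb := C.vertex_lt b hb.1
  coord_smul c m := C.coord_smul c m.1
  injective := C.injective.comp Subtype.val_injective
  support m b hb := by
    by_cases h : b ∈ R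
    · by_cases h' : b ∈ remaining R z
      · exact (C.mem_socWord_iff z m.1).1 m.2 b h'
      · exact absurd ⟨h, h'⟩ hb
    · exact C.support _ _ h
  exists_of_support f hf := by
    obtain ⟨m, hm⟩ := C.exists_of_support f fun b hb => hf b fun h => hb h.1
    exact ⟨⟨m, (C.mem_socWord_iff z m).2 fun b hb => by
      rw [hm]; exact hf b fun h => h.2 hb⟩, hm⟩
  coord_e i m b := C.coord_e i m.1 b
  coord_al a m l r h := C.coord_al a m.1 l r h.1
  coord_al_zero a m b h := C.coord_al_zero a m.1 b h
  coord_als a m l r h := C.coord_als a m.1 l r h.1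

theorem nonempty_edagWord {N : ModuleCat.{0} (Preproj n)} {R : Set (ℕ × ℕ)}
    (C : DiagramCoord (n := n) N R) (z : List (Vtx n)) :
    Nonempty (DiagramCoord (n := n) (EdagWord z N) (remaining R z)) := by
  induction z with
  | nil => exact ⟨C⟩
  | cons i z ih =>
    obtain ⟨D⟩ := ih
    exact ⟨D.quotientSoc i⟩

open Classical in
-- The basis consists of the elements whose coordinate functions are the indicators of single
-- points. The bijection `σ` need only match labels and the two adjacency relations.
theorem hasCompositionDiagram {k : ℕ} {N : ModuleCat.{0} (Preproj n)} {R : Set (ℕ × ℕ)}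
    (C : DiagramCoord (n := n) N R) (S : Finset (Box n k)) (σ : Box n k → ℕ × ℕ)
    (hσ : Set.BijOn σ S R) (hlabel : ∀ b ∈ S, (σ b).1 = (rotLabel b).1)
    (hbelow : ∀ b ∈ S, ∀ b' ∈ S, Below b b' ↔ σ b' = ((σ b).1 + 1, (σ b).2 + 1))
    (hright : ∀ b ∈ S, ∀ b' ∈ S, RightOf b b' ↔ σ b = ((σ b').1 + 1, (σ b').2)) :
    HasCompositionDiagram N S := by
  let _ : Module ℂ N := Module.compHom N (algebraMap ℂ (Preproj n))
  have hσR : ∀ b : S, σ b ∈ R := fun b => hσ.mapsTo b.2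
  have hσsurj : ∀ c ∈ R, ∃ b : S, σ b = c := fun c hc => by
    obtain ⟨b, hb, rfl⟩ := hσ.surjOn hc; exact ⟨⟨b, hb⟩, rfl⟩
  let L : N →ₗ[ℂ] (S → ℂ) :=
    { toFun := fun m b => C.coord m (σ b)
      map_add' := fun x y => by funext b; simp
      map_smul' := fun c x => by
        funext b
        exact congrFun (C.coord_smul c x) _ }
  have hL : Function.Bijective L := by
    constructor
    · rw [injective_iff_map_eq_zero]
      intro m hm
      apply C.injective
      rw [map_zero]
      funext c
      by_cases hc : c ∈ R
      · obtain ⟨b, rfl⟩ := hσsurj c hc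
        exact congrFun hm b
      · exact C.support _ _ hc
    · intro f
      obtain ⟨m, hm⟩ := C.exists_of_support
        (fun c => if h : ∃ b : S, σ b = c then f h.choose else 0) (by
          intro c hc
          refine dif_neg ?_
          rintro ⟨b, rfl⟩
          exact hc (hσR b))
      refine ⟨m, ?_⟩
      funext b
      change C.coord m (σ b) = f b
      have hex : ∃ b' : S, σ b' = σ b := ⟨b, rfl⟩
      have hch : hex.choose = b :=
        Subtype.ext (hσ.injOn hex.choose.2 b.2 hex.choose_spec)
      rw [hm]
      simp only [hex, dif_pos]
      exact congrArg f hch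
  let B : Module.Basis S ℂ N := Module.Basis.ofEquivFun (LinearEquiv.ofBijective L hL)
  have hBL : ∀ b, L (B b) = Pi.single b 1 := fun b => by
    simp only [B, Module.Basis.coe_ofEquivFun]
    exact (LinearEquiv.ofBijective L hL).apply_symm_apply _
  have hB : ∀ (b : S) (c : ℕ × ℕ), C.coord (B b) c = if c = σ b then 1 else 0 := by
    intro b c
    by_cases hc : c ∈ R
    · obtain ⟨b', rfl⟩ := hσsurj c hc
      have := congrFun (hBL b) b'
      change C.coord (B b) (σ b') = _ at this
      rw [this, Pi.single_apply]
      congr 1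
      exact propext ⟨fun h => by rw [h], fun h => Subtype.ext (hσ.injOn b'.2 b.2 h)⟩
    · rw [C.support _ _ hc, if_neg]
      rintro rfl
      exact hc (hσR b)
  have hal : ∀ (a : Arr n) (b : S) (c : ℕ × ℕ), src a = rotLabel b.1 →
      C.coord ((gen (Gen.al a) : Preproj n) • B b) c =
        if c ∈ R ∧ c = ((σ b).1 + 1, (σ b).2 + 1) then 1 else 0 := by
    intro a b c hab
    have hab' : a.1 = (σ b).1 := by rw [hlabel b b.2, ← hab]; rfl
    by_cases hc : c ∈ R
    · obtain ⟨l, r⟩ := c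
      rcases l with _ | l
      · rw [C.coord_al_zero _ _ _ (Or.inl rfl), if_neg]; simp
      rcases r with _ | r
      · rw [C.coord_al_zero _ _ _ (Or.inr rfl), if_neg]; simp
      rw [C.coord_al _ _ _ _ hc, hB, hab']
      simp only [hc, true_and, Prod.ext_iff, add_left_inj]
      split_ifs <;> simp_all
    · rw [C.support _ _ hc, if_neg (fun h => hc h.1)]
  have hals : ∀ (a : Arr n) (b : S) (c : ℕ × ℕ), tgt a = rotLabel b.1 →
      C.coord ((gen (Gen.als a) : Preproj n) • B b) c =
        if c ∈ R ∧ σ b = (c.1 + 1, c.2) then 1 else 0 := by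
    intro a b c hab
    have hab' : a.1 + 1 = (σ b).1 := by rw [hlabel b b.2, ← hab]; rfl
    by_cases hc : c ∈ R
    · rw [C.coord_als _ _ _ _ hc, hB]
      have : (c.1 + 1, c.2) = σ b ↔ c.1 = a.1 ∧ σ b = (c.1 + 1, c.2) := by
        rw [Prod.ext_iff, Prod.ext_iff]
        simp only
        omega
      by_cases h : σ b = (c.1 + 1, c.2)
      · have h1 := (this.1 h.symm).1
        simp [hc, h, h1]
      · simp [h, Ne.symm h]
    · rw [C.support _ _ hc, if_neg (fun h => hc h.1)]
  refine ⟨B, ?_, ?_, ?_, ?_, ?_⟩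
  · intro i b
    apply C.injective
    funext c
    rw [C.coord_e, hB]
    by_cases h : rotLabel b.1 = i
    · rw [if_pos h, hB]
      by_cases hc : c = σ b
      · rw [hc, hlabel b b.2, h]; simp
      · simp [hc]
    · rw [if_neg h, map_zero]
      by_cases hc : c = σ b
      · rw [hc, hlabel b b.2, if_neg (fun h' => h (Fin.ext h'))]; rfl
      · simp [hc]
  · intro a b b' hab hbb
    apply C.injective
    funext c
    rw [hal a b c hab, hB, ← (hbelow b b.2 b' b'.2).1 hbb]
    congr 1
    exact propext ⟨fun h => h.2, fun h => ⟨h ▸ hσR b', h⟩⟩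
  · intro a b hab hno
    apply C.injective
    funext c
    rw [hal a b c hab, map_zero, if_neg]
    · rfl
    · rintro ⟨hc, h⟩
      obtain ⟨b', rfl⟩ := hσsurj c hc
      exact hno b' ((hbelow b b.2 b' b'.2).2 h)
  · intro a b b' hab hbb
    apply C.injective
    funext c
    have h0 := (hright b b.2 b' b'.2).1 hbb
    rw [hals a b c hab, hB, h0]
    congr 1
    refine propext ⟨fun h => ?_, fun h => ⟨h ▸ hσR b', by rw [h]⟩⟩
    have := h.2
    simp only [Prod.mk.injEq, add_left_inj] at this
    exact Prod.ext this.1.symm this.2.symm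
  · intro a b hab hno
    apply C.injective
    funext c
    rw [hals a b c hab, map_zero, if_neg]
    · rfl
    · rintro ⟨hc, h⟩
      obtain ⟨b', rfl⟩ := hσsurj c hc
      exact hno b' ((hright b b.2 b' b'.2).2 h)

end DiagramCoord

/-! ### The path basis of `e_i Λ` and coordinates on the injective modules -/

/-- The sum of the arrows `α_a`. -/
noncomputable def sumAl (n : ℕ) : Preproj n := ∑ a : Arr n, gen (Gen.al a)

/-- The sum of the arrows `α_a^*`. -/
noncomputable def sumAls (n : ℕ) : Preproj n := ∑ a : Arr n, gen (Gen.als a)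

theorem src_injective {n : ℕ} : Function.Injective (src (n := n)) := fun _ _ h =>
  Fin.ext (congrArg (fun l : Vtx n => l.1) h)

theorem tgt_injective {n : ℕ} : Function.Injective (tgt (n := n)) := fun a b h => by
  have := congrArg Fin.val h
  simp only [tgt, Nat.add_right_cancel_iff] at this
  exact Fin.ext this

theorem gen_al_mul_gen_e_of_ne {n : ℕ} {a : Arr n} {l : Vtx n} (h : src a ≠ l) :
    (gen (Gen.al a) : Preproj n) * gen (Gen.e l) = 0 := by
  rw [← gen_al_mul_src, mul_assoc, gen_e_orth h, mul_zero]

theorem gen_als_mul_gen_e_of_ne {n : ℕ} {a : Arr n} {l : Vtx n} (h : tgt a ≠ l) :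
    (gen (Gen.als a) : Preproj n) * gen (Gen.e l) = 0 := by
  rw [← gen_als_mul_tgt, mul_assoc, gen_e_orth h, mul_zero]

theorem gen_e_mul_gen_al_of_ne {n : ℕ} {a : Arr n} {l : Vtx n} (h : l ≠ tgt a) :
    (gen (Gen.e l) : Preproj n) * gen (Gen.al a) = 0 := by
  rw [← gen_tgt_mul_al, ← mul_assoc, gen_e_orth h, zero_mul]

theorem gen_e_mul_gen_als_of_ne {n : ℕ} {a : Arr n} {l : Vtx n} (h : l ≠ src a) :
    (gen (Gen.e l) : Preproj n) * gen (Gen.als a) = 0 := by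
  rw [← gen_src_mul_als, ← mul_assoc, gen_e_orth h, zero_mul]

/-- Idempotents cut single arrows out of the sums `sumAl` and `sumAls`, so computations can be done
with two commuting elements in place of all the arrows. -/
theorem sumAl_mul_src {n : ℕ} (a : Arr n) : sumAl n * gen (Gen.e (src a)) = gen (Gen.al a) := by
  rw [sumAl, Finset.sum_mul, Finset.sum_eq_single a, gen_al_mul_src]
  · intro b _ hb
    exact gen_al_mul_gen_e_of_ne fun h => hb (src_injective h)
  · simp

theorem tgt_mul_sumAl {n : ℕ} (a : Arr n) : gen (Gen.e (tgt a)) * sumAl n = gen (Gen.al a) := by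
  rw [sumAl, Finset.mul_sum, Finset.sum_eq_single a, gen_tgt_mul_al]
  · intro b _ hb
    exact gen_e_mul_gen_al_of_ne fun h => hb (tgt_injective h).symm
  · simp

theorem sumAls_mul_tgt {n : ℕ} (a : Arr n) : sumAls n * gen (Gen.e (tgt a)) = gen (Gen.als a) := by
  rw [sumAls, Finset.sum_mul, Finset.sum_eq_single a, gen_als_mul_tgt]
  · intro b _ hb
    exact gen_als_mul_gen_e_of_ne fun h => hb (tgt_injective h)
  · simp

theorem src_mul_sumAls {n : ℕ} (a : Arr n) : gen (Gen.e (src a)) * sumAls n = gen (Gen.als a) := by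
  rw [sumAls, Finset.mul_sum, Finset.sum_eq_single a, gen_src_mul_als]
  · intro b _ hb
    exact gen_e_mul_gen_als_of_ne fun h => hb (src_injective h).symm
  · simp

/-- In both products the terms with two different arrows vanish, and the difference of the remaining
sums is the preprojective relation. -/
theorem commute_sumAl_sumAls (n : ℕ) : Commute (sumAl n) (sumAls n) := by
  have h1 : sumAl n * sumAls n = ∑ a : Arr n, gen (Gen.al a) * gen (Gen.als a) := by
    rw [sumAl, Finset.sum_mul]
    refine Finset.sum_congr rfl fun a _ => ?_
    rw [← gen_al_mul_src, mul_assoc, src_mul_sumAls, mul_assoc, gen_src_mul_als]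
  have h2 : sumAls n * sumAl n = ∑ a : Arr n, gen (Gen.als a) * gen (Gen.al a) := by
    rw [sumAls, Finset.sum_mul]
    refine Finset.sum_congr rfl fun a _ => ?_
    rw [← gen_als_mul_tgt, mul_assoc, tgt_mul_sumAl, mul_assoc, gen_tgt_mul_al]
  change sumAl n * sumAls n = sumAls n * sumAl n
  rw [h1, h2, ← sub_eq_zero, ← Finset.sum_sub_distrib, sum_gen_preproj]

theorem gen_e_mul_sumAl_pow {n : ℕ} (p : ℕ) {i l : Vtx n} (h : i.1 = l.1 + p) :
    gen (Gen.e i) * sumAl n ^ p = sumAl n ^ p * gen (Gen.e l) := by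
  induction p generalizing i with
  | zero => rw [Fin.ext (show i.1 = l.1 from h)]; simp
  | succ p ih =>
    have hi := i.2
    let a : Arr n := ⟨i.1 - 1, by omega⟩
    have ht : i = tgt a := Fin.ext (by simp [tgt, a]; omega)
    rw [pow_succ', ← mul_assoc, ht, tgt_mul_sumAl, ← sumAl_mul_src, mul_assoc,
      ih (i := src a) (by simp [src, a]; omega), mul_assoc]

/-- Such a path ending at `i` would have to start before the first vertex. -/
theorem gen_e_mul_sumAl_pow_eq_zero {n : ℕ} (p : ℕ) {i : Vtx n} (h : i.1 < p) :
    gen (Gen.e i) * sumAl n ^ p = 0 := by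
  have hi := i.2
  have h0 : (gen (Gen.e (⟨0, by omega⟩ : Vtx n)) : Preproj n) * sumAl n = 0 := by
    rw [sumAl, Finset.mul_sum, Finset.sum_eq_zero]
    intro a _
    exact gen_e_mul_gen_al_of_ne fun h => by
      have := congrArg Fin.val h
      simp [tgt] at this
  obtain ⟨q, rfl⟩ := Nat.exists_eq_add_of_lt h
  rw [show i.1 + q + 1 = i.1 + (q + 1) by ring, pow_add, ← mul_assoc,
    gen_e_mul_sumAl_pow i.1 (l := ⟨0, by omega⟩) (by simp), mul_assoc, pow_succ',
    ← mul_assoc (gen _), h0, zero_mul, mul_zero]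

theorem gen_e_mul_sumAls_pow {n : ℕ} (q : ℕ) {i l : Vtx n} (h : l.1 = i.1 + q) :
    gen (Gen.e i) * sumAls n ^ q = sumAls n ^ q * gen (Gen.e l) := by
  induction q generalizing i with
  | zero => rw [Fin.ext (show l.1 = i.1 from h)]; simp
  | succ q ih =>
    have hl := l.2
    let a : Arr n := ⟨i.1, by omega⟩
    have ht : i = src a := rfl
    rw [pow_succ', ← mul_assoc, ht, src_mul_sumAls, ← sumAls_mul_tgt, mul_assoc,
      ih (i := tgt a) (by simp [tgt, a]; omega), mul_assoc]

theorem gen_e_mul_sumAls_pow_eq_zero {n : ℕ} (q : ℕ) {i : Vtx n} (h : n ≤ i.1 + q + 1) :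
    gen (Gen.e i) * sumAls n ^ q = 0 := by
  have hi := i.2
  have h0 : (gen (Gen.e (⟨n - 2, by omega⟩ : Vtx n)) : Preproj n) * sumAls n = 0 := by
    rw [sumAls, Finset.mul_sum, Finset.sum_eq_zero]
    intro a _
    exact gen_e_mul_gen_als_of_ne fun h => by
      have h1 := congrArg Fin.val h
      have h2 := a.2
      simp only [src] at h1
      omega
  obtain ⟨t, rfl⟩ : ∃ t, q = (n - 2 - i.1) + (t + 1) := ⟨q - 1 - (n - 2 - i.1), by omega⟩
  rw [pow_add, ← mul_assoc, gen_e_mul_sumAls_pow (n - 2 - i.1) (l := ⟨n - 2, by omega⟩)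
    (by simp; omega), mul_assoc, pow_succ', ← mul_assoc (gen _), h0, zero_mul,
    mul_zero]

/-- The path `α^p (α^*)^q`. -/
noncomputable def monomial (n p q : ℕ) : Preproj n := sumAl n ^ p * sumAls n ^ q

theorem monomial_mul_sumAl (n p q : ℕ) : monomial n p q * sumAl n = monomial n (p + 1) q := by
  rw [monomial, monomial, mul_assoc, ((commute_sumAl_sumAls n).pow_right q).symm.eq, ← mul_assoc,
    pow_succ]

theorem monomial_mul_sumAls (n p q : ℕ) : monomial n p q * sumAls n = monomial n p (q + 1) := by
  rw [monomial, monomial, mul_assoc, pow_succ]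

theorem gen_e_mul_monomial {n : ℕ} {i l : Vtx n} {p q : ℕ} (hp : p ≤ i.1)
    (h : i.1 + q = l.1 + p) :
    gen (Gen.e i) * monomial n p q = monomial n p q * gen (Gen.e l) := by
  rw [monomial, ← mul_assoc, gen_e_mul_sumAl_pow p (l := ⟨i.1 - p, by omega⟩) (by simp; omega),
    mul_assoc, gen_e_mul_sumAls_pow q (l := l) (by simp; omega), mul_assoc]

theorem gen_e_mul_monomial_eq_zero {n : ℕ} {i : Vtx n} {p q : ℕ}
    (h : ¬ (p ≤ i.1 ∧ i.1 + q + 2 ≤ n)) : gen (Gen.e i) * monomial n p q = 0 := by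
  by_cases hp : p ≤ i.1
  · rw [monomial, ((commute_sumAl_sumAls n).pow_pow p q).eq, ← mul_assoc,
      gen_e_mul_sumAls_pow_eq_zero q (by omega), zero_mul]
  · rw [monomial, ← mul_assoc, gen_e_mul_sumAl_pow_eq_zero p (by omega), zero_mul]

theorem gen_e_mul_monomial_mul_gen_e {n : ℕ} (i m : Vtx n) (p q : ℕ) :
    gen (Gen.e i) * monomial n p q * gen (Gen.e m) =
      if i.1 + q = m.1 + p then gen (Gen.e i) * monomial n p q else 0 := by
  by_cases h : p ≤ i.1 ∧ i.1 + q + 2 ≤ n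
  · let l : Vtx n := ⟨i.1 + q - p, by omega⟩
    have hl : i.1 + q = l.1 + p := by simp [l]; omega
    rw [gen_e_mul_monomial h.1 hl, mul_assoc]
    by_cases hm : l = m
    · rw [← hm, gen_e_idem, if_pos hl]
    · rw [gen_e_orth hm, mul_zero, if_neg]
      intro h'
      exact hm (Fin.ext (by omega))
  · rw [gen_e_mul_monomial_eq_zero h]; simp

/-- The span contains `e_i` and is stable under right multiplication by generators: these raise one
exponent, by commutativity, and then cut by an idempotent, which keeps or kills a monomial. -/
theorem gen_e_mul_mem_span {n : ℕ} (i : Vtx n) (y : Preproj n) :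
    gen (Gen.e i) * y ∈ Submodule.span ℂ
      (Set.range fun pq : ℕ × ℕ => gen (Gen.e i) * monomial n pq.1 pq.2) := by
  set W := Submodule.span ℂ
      (Set.range fun pq : ℕ × ℕ => gen (Gen.e i) * monomial n pq.1 pq.2)
  have mem : ∀ p q, gen (Gen.e i) * monomial n p q ∈ W := fun p q =>
    Submodule.subset_span ⟨(p, q), rfl⟩
  have mem_e : ∀ p q m, gen (Gen.e i) * monomial n p q * gen (Gen.e m) ∈ W := fun p q m => by
    rw [gen_e_mul_monomial_mul_gen_e]
    split_ifs
    · exact mem p q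
    · exact zero_mem _
  suffices h : ∀ w ∈ W, w * y ∈ W by
    exact h _ (by simpa [monomial] using mem 0 0)
  induction y using preproj_induction with
  | hscalar c =>
    intro w hw
    rw [← Algebra.commutes, ← Algebra.smul_def]
    exact W.smul_mem c hw
  | hgen g =>
    have : W ≤ W.comap (LinearMap.mulRight ℂ (gen g)) := by
      rw [Submodule.span_le]
      rintro _ ⟨⟨p, q⟩, rfl⟩
      change gen (Gen.e i) * monomial n p q * gen g ∈ W
      cases g with
      | e m => exact mem_e p q m
      | al a =>
        rw [← sumAl_mul_src, ← mul_assoc, mul_assoc (gen _), monomial_mul_sumAl]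
        exact mem_e _ _ _
      | als a =>
        rw [← sumAls_mul_tgt, ← mul_assoc, mul_assoc (gen _), monomial_mul_sumAls]
        exact mem_e _ _ _
    exact this
  | hmul a b ha hb =>
    intro w hw
    rw [← mul_assoc]
    exact hb _ (ha _ hw)
  | hadd a b ha hb =>
    intro w hw
    rw [mul_add]
    exact add_mem (ha _ hw) (hb _ hw)

/-- The rectangle of the injective module `Q_i`. -/
def injRect (n i : ℕ) : Set (ℕ × ℕ) := {b | b.2 ≤ i ∧ b.2 ≤ b.1 ∧ b.1 + i + 2 ≤ b.2 + n}

open Classical in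
/-- The action of a generator on the functions on the rectangle of `Q_i`. -/
noncomputable def rectAction {n : ℕ} (i : Vtx n) : Gen n → Module.End ℂ (Vtx n × ℕ → ℂ)
  | Gen.e l =>
    { toFun := fun G b => if b.1 = l then G b else 0
      map_add' := fun x y => by funext b; by_cases h : b.1 = l <;> simp [h]
      map_smul' := fun c x => by funext b; by_cases h : b.1 = l <;> simp [h] }
  | Gen.al a =>
    { toFun := fun G b => if b.1 = tgt a ∧ 1 ≤ b.2 ∧ (b.1.1, b.2) ∈ injRect n i then
        G (src a, b.2 - 1) else 0
      map_add' := fun x y => by funext b; simp only [Pi.add_apply]; split_ifs <;> simp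
      map_smul' := fun c x => by
        funext b; simp only [Pi.smul_apply, RingHom.id_apply]; split_ifs <;> simp }
  | Gen.als a =>
    { toFun := fun G b => if b.1 = src a ∧ (b.1.1, b.2) ∈ injRect n i ∧
        (b.1.1 + 1, b.2) ∈ injRect n i then G (tgt a, b.2) else 0
      map_add' := fun x y => by funext b; simp only [Pi.add_apply]; split_ifs <;> simp
      map_smul' := fun c x => by
        funext b; simp only [Pi.smul_apply, RingHom.id_apply]; split_ifs <;> simp }

open Classical in
theorem rectAction_e {n : ℕ} (i l : Vtx n) (G : Vtx n × ℕ → ℂ) (b : Vtx n × ℕ) :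
    rectAction i (Gen.e l) G b = if b.1 = l then G b else 0 := rfl

open Classical in
theorem rectAction_al {n : ℕ} (i : Vtx n) (a : Arr n) (G : Vtx n × ℕ → ℂ) (b : Vtx n × ℕ) :
    rectAction i (Gen.al a) G b = if b.1 = tgt a ∧ 1 ≤ b.2 ∧ (b.1.1, b.2) ∈ injRect n i then
        G (src a, b.2 - 1) else 0 := rfl

open Classical in
theorem rectAction_als {n : ℕ} (i : Vtx n) (a : Arr n) (G : Vtx n × ℕ → ℂ) (b : Vtx n × ℕ) :
    rectAction i (Gen.als a) G b = if b.1 = src a ∧ (b.1.1, b.2) ∈ injRect n i ∧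
        (b.1.1 + 1, b.2) ∈ injRect n i then G (tgt a, b.2) else 0 := rfl

/-- At `(l, r)` each sum has at most one nonzero term, and both terms read off the value at `(l, r -
1)`. The rectangle is such that the two detours are available under the same conditions. -/
theorem rectAction_preproj {n : ℕ} (i : Vtx n) (G : Vtx n × ℕ → ℂ) (b : Vtx n × ℕ) :
    ∑ a : Arr n, rectAction i (Gen.al a) (rectAction i (Gen.als a) G) b =
      ∑ a : Arr n, rectAction i (Gen.als a) (rectAction i (Gen.al a) G) b := by
  obtain ⟨l, r⟩ := b
  have hl := l.2
  have hi := i.2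
  by_cases H : 1 ≤ r ∧ (l.1, r) ∈ injRect n i ∧ (l.1 + 1, r) ∈ injRect n i
  · obtain ⟨h1, h2, h3⟩ := H
    have h2' := h2
    have h3' := h3
    simp only [injRect, Set.mem_ofPred_eq] at h2' h3'
    let x : Arr n := ⟨l.1 - 1, by omega⟩
    let y : Arr n := ⟨l.1, by omega⟩
    have hx : l = tgt x := Fin.ext (by simp [tgt, x]; omega)
    have hy : l = src y := rfl
    have hxl : (tgt x).1 = l.1 := by rw [← hx]
    have hxs : (src x).1 = l.1 - 1 := rfl
    have hys : (tgt y).1 = l.1 + 1 := rfl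
    rw [Finset.sum_eq_single x, Finset.sum_eq_single y]
    · rw [rectAction_al, rectAction_als, rectAction_als, rectAction_al, if_pos, if_pos, if_pos,
        if_pos]
      · simp only [← hx, ← hy]
      · exact ⟨rfl, h1, by rw [hys]; exact h3⟩
      · exact ⟨hy, h2, h3⟩
      · simp only [injRect, Set.mem_ofPred_eq, hxs]
        refine ⟨trivial, ?_, ?_⟩ <;> omega
      · exact ⟨hx, h1, h2⟩
    · intro a _ ha
      rw [rectAction_als, if_neg]
      rintro ⟨h, -⟩
      exact ha (src_injective (h.symm.trans hy))
    · simp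
    · intro a _ ha
      rw [rectAction_al, if_neg]
      rintro ⟨h, -⟩
      exact ha (tgt_injective (h.symm.trans hx))
    · simp
  · rw [Finset.sum_eq_zero, Finset.sum_eq_zero]
    · intro a _
      rw [rectAction_als, rectAction_al]
      split_ifs with h1 h2
      · exact absurd ⟨h2.2.1, h1.2⟩ H
      · rfl
      · rfl
    · intro a _
      rw [rectAction_al, rectAction_als]
      split_ifs with h1 h2
      -- For the upper bound defining the rectangle, `(l, r - 1)` inside is the same as `(l + 1, r)`
      -- inside.
      · refine absurd ⟨h1.2.1, h1.2.2, ?_⟩ H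
        have h3 := congrArg Fin.val h1.1
        have h4 := h1.2
        have h5 := h2.2
        simp only [injRect, Set.mem_ofPred_eq, src, tgt] at h3 h4 h5 ⊢
        omega
      · rfl
      · rfl

/-- The representation of `Λ` on the functions on the rectangle of `Q_i`. -/
noncomputable def rectRep {n : ℕ} (i : Vtx n) :
    Preproj n →ₐ[ℂ] Module.End ℂ (Vtx n × ℕ → ℂ) :=
  RingQuot.liftAlgHom ℂ ⟨FreeAlgebra.lift ℂ (rectAction i), by
    intro x y h
    cases h with
    | idem l =>
      ext1 G; funext b
      simp only [map_mul, FreeAlgebra.lift_ι_apply, Module.End.mul_apply, rectAction_e]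
      split_ifs <;> rfl
    | orth l m h =>
      ext1 G; funext b
      simp only [map_mul, FreeAlgebra.lift_ι_apply, Module.End.mul_apply, rectAction_e, map_zero,
        LinearMap.zero_apply, Pi.zero_apply]
      split_ifs with h1 h2
      · exact absurd (h1.symm.trans h2) h
      · rfl
      · rfl
    | one =>
      ext1 G; funext b
      simp only [map_sum, FreeAlgebra.lift_ι_apply, map_one, LinearMap.sum_apply,
        Finset.sum_apply, rectAction_e, Module.End.one_apply]
      simp
    | al_tgt a =>
      ext1 G; funext b
      simp only [map_mul, FreeAlgebra.lift_ι_apply, Module.End.mul_apply, rectAction_e,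
        rectAction_al]
      split_ifs with h1 h2 h2
      · rfl
      · rfl
      · exact absurd h2.1 h1
      · rfl
    | al_src a =>
      ext1 G; funext b
      simp only [map_mul, FreeAlgebra.lift_ι_apply, Module.End.mul_apply, rectAction_e,
        rectAction_al, if_true]
    | als_tgt a =>
      ext1 G; funext b
      simp only [map_mul, FreeAlgebra.lift_ι_apply, Module.End.mul_apply, rectAction_e,
        rectAction_als]
      split_ifs with h1 h2 h2
      · rfl
      · rfl
      · exact absurd h2.1 h1
      · rfl
    | als_src a =>
      ext1 G; funext b
      simp only [map_mul, FreeAlgebra.lift_ι_apply, Module.End.mul_apply, rectAction_e,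
        rectAction_als, if_true]
    | preproj =>
      ext1 G; funext b
      simp only [map_sum, map_sub, map_mul, FreeAlgebra.lift_ι_apply, LinearMap.sum_apply,
        Finset.sum_apply, LinearMap.sub_apply, Pi.sub_apply, Module.End.mul_apply, map_zero,
        LinearMap.zero_apply, Pi.zero_apply, Finset.sum_sub_distrib, rectAction_preproj, sub_self]⟩

theorem rectRep_gen {n : ℕ} (i : Vtx n) (g : Gen n) : rectRep i (gen g) = rectAction i g := by
  simp only [rectRep, gen, RingQuot.liftAlgHom_mkAlgHom_apply, FreeAlgebra.lift_ι_apply]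

/-- Powers of `sumAl`, and of `sumAls` below, read a function `p` or `q` places back. Together they
let a monomial extract a prescribed value, which replaces a proof of linear independence. -/
theorem rectRep_sumAl_pow {n : ℕ} (i : Vtx n) (G : Vtx n × ℕ → ℂ) (p : ℕ) {l l' : Vtx n}
    {r r' : ℕ} (hl : l.1 = l'.1 + p) (hr : r = r' + p) (h : (l.1, r) ∈ injRect n i) :
    rectRep i (sumAl n ^ p) G (l, r) = G (l', r') := by
  induction p generalizing l r with
  | zero => simp [Fin.ext (show l.1 = l'.1 from hl), hr]
  | succ p ih =>
    have hlt := l.2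
    let a : Arr n := ⟨l.1 - 1, by omega⟩
    have ha : l = tgt a := Fin.ext (by simp [tgt, a]; omega)
    rw [pow_succ', map_mul, Module.End.mul_apply, sumAl, map_sum, LinearMap.sum_apply,
      Finset.sum_apply, Finset.sum_eq_single a]
    · rw [rectRep_gen, rectAction_al, if_pos ⟨ha, by simp only; omega, h⟩]
      simp only [injRect, Set.mem_ofPred_eq] at h
      exact ih (by simp [src, a]; omega) (by simp only; omega)
        (by simp only [injRect, Set.mem_ofPred_eq, src, a]; omega)
    · intro b _ hb
      rw [rectRep_gen, rectAction_al, if_neg]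
      rintro ⟨h, -⟩
      exact hb (tgt_injective (h.symm.trans ha))
    · simp

theorem rectRep_sumAls_pow {n : ℕ} (i : Vtx n) (G : Vtx n × ℕ → ℂ) (q : ℕ) {l l' : Vtx n}
    {r : ℕ} (hl : l'.1 = l.1 + q) (h : (l.1, r) ∈ injRect n i) (h' : (l'.1, r) ∈ injRect n i) :
    rectRep i (sumAls n ^ q) G (l, r) = G (l', r) := by
  induction q generalizing l with
  | zero => simp [Fin.ext (show l'.1 = l.1 from hl)]
  | succ q ih =>
    have hlt := l'.2
    let a : Arr n := ⟨l.1, by omega⟩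
    have ha : l = src a := rfl
    have hm : (l.1 + 1, r) ∈ injRect n i := by
      simp only [injRect, Set.mem_ofPred_eq] at h h' ⊢; omega
    rw [pow_succ', map_mul, Module.End.mul_apply, sumAls, map_sum, LinearMap.sum_apply,
      Finset.sum_apply, Finset.sum_eq_single a]
    · rw [rectRep_gen, rectAction_als, if_pos ⟨ha, h, hm⟩]
      exact ih (by simp [tgt, a]; omega) hm
    · intro b _ hb
      rw [rectRep_gen, rectAction_als, if_neg]
      rintro ⟨h, -⟩
      exact hb (src_injective (h.symm.trans ha))
    · simp

/-- The value of an element of `Q_i` at `e_i y`. -/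
noncomputable def evalInj {n : ℕ} {i : Vtx n} (f : InjMod i) (y : Preproj n) : ℂ :=
  (show rightIdeal i →ₗ[ℂ] ℂ from f) ⟨gen (Gen.e i) * y, ⟨y, rfl⟩⟩

theorem evalInj_smul {n : ℕ} {i : Vtx n} (a : Preproj n) (f : InjMod i) (y : Preproj n) :
    evalInj (a • f) y = evalInj f (y * a) :=
  congrArg (show rightIdeal i →ₗ[ℂ] ℂ from f) (Subtype.ext (mul_assoc _ _ _))

theorem evalInj_congr {n : ℕ} {i : Vtx n} (f : InjMod i) {y y' : Preproj n}
    (h : gen (Gen.e i) * y = gen (Gen.e i) * y') : evalInj f y = evalInj f y' :=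
  congrArg (show rightIdeal i →ₗ[ℂ] ℂ from f) (Subtype.ext h)

theorem evalInj_eq_zero {n : ℕ} {i : Vtx n} (f : InjMod i) {y : Preproj n}
    (h : gen (Gen.e i) * y = 0) : evalInj f y = 0 :=
  (congrArg (show rightIdeal i →ₗ[ℂ] ℂ from f) (Subtype.ext h)).trans (map_zero _)

theorem evalInj_scalar {n : ℕ} {i : Vtx n} (f : InjMod i) (c : ℂ) (y : Preproj n) :
    evalInj f (y * algebraMap ℂ (Preproj n) c) = c * evalInj f y := by
  refine (congrArg (show rightIdeal i →ₗ[ℂ] ℂ from f) (Subtype.ext ?_)).trans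
    (map_smul (show rightIdeal i →ₗ[ℂ] ℂ from f) c ⟨gen (Gen.e i) * y, ⟨y, rfl⟩⟩)
  change gen (Gen.e i) * (y * algebraMap ℂ (Preproj n) c) = c • (gen (Gen.e i) * y)
  rw [← mul_assoc, ← Algebra.commutes, ← Algebra.smul_def]

/-- The monomials `e_i A^p A*^q` span `e_i Λ`, so a functional is determined by its values on them.
-/
theorem eq_zero_of_evalInj_monomial {n : ℕ} {i : Vtx n} (f : InjMod i)
    (h : ∀ p q, evalInj f (monomial n p q) = 0) : f = 0 := by
  refine LinearMap.ext (f := (show rightIdeal i →ₗ[ℂ] ℂ from f)) (g := 0) ?_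
  rintro ⟨_, ⟨y, rfl⟩⟩
  have hle : Submodule.span ℂ
      (Set.range fun pq : ℕ × ℕ => gen (Gen.e i) * monomial n pq.1 pq.2) ≤
      (LinearMap.ker (show rightIdeal i →ₗ[ℂ] ℂ from f)).map (rightIdeal i).subtype := by
    rw [Submodule.span_le]
    rintro _ ⟨⟨p, q⟩, rfl⟩
    exact ⟨⟨_, ⟨monomial n p q, rfl⟩⟩, h p q, rfl⟩
  obtain ⟨w, hw, hwy⟩ := hle (gen_e_mul_mem_span i y)
  have : w = ⟨gen (Gen.e i) * y, ⟨y, rfl⟩⟩ := Subtype.ext hwy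
  rw [this] at hw
  exact hw

open Classical in
/-- The coordinates on `Q_i` dual to the paths `e_i α^p (α^*)^q`. -/
noncomputable def injCoord {n : ℕ} (i : Vtx n) :
    DiagramCoord (n := n) (InjMod i) (injRect n i) where
  coord :=
    { toFun := fun f b => if b ∈ injRect n i then
        evalInj f (monomial n (i.1 - b.2) (b.1 - b.2)) else 0
      map_zero' := by
        funext b
        split_ifs <;> rfl
      map_add' := fun f g => by
        funext b
        simp only [Pi.add_apply]
        split_ifs
        · rfl
        · simp }
  vertex_lt b hb := by
    have := i.2
    simp only [injRect, Set.mem_ofPred_eq] at hb; omega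
  coord_smul c f := by
    funext b
    simp only [AddMonoidHom.coe_mk, ZeroHom.coe_mk, Pi.smul_apply, smul_eq_mul, evalInj_smul,
      evalInj_scalar]
    split_ifs <;> simp
  injective := by
    rw [injective_iff_map_eq_zero]
    intro f hf
    apply eq_zero_of_evalInj_monomial
    intro p q
    by_cases h : p ≤ i.1 ∧ i.1 + q + 2 ≤ n
    · have h1 := congrFun hf (i.1 - p + q, i.1 - p)
      have hb : (i.1 - p + q, i.1 - p) ∈ injRect n i := by
        simp only [injRect, Set.mem_ofPred_eq]; omega
      simp only [AddMonoidHom.coe_mk, ZeroHom.coe_mk, hb, if_true] at h1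
      rwa [show i.1 - (i.1 - p) = p by omega, show i.1 - p + q - (i.1 - p) = q by omega] at h1
    · exact evalInj_eq_zero f (gen_e_mul_monomial_eq_zero h)
  support f b hb := if_neg hb
  exists_of_support F hF := by
    let G : Vtx n × ℕ → ℂ := fun b => F (b.1.1, b.2)
    -- The functional evaluates at the socle corner `(i, i)`. The monomial with exponents `i - r`
    -- and `l - r` moves from there to `(r, r)` and then to `(l, r)`, so `φ` takes the value `F (l,
    -- r)` on it.
    let φ : rightIdeal i →ₗ[ℂ] ℂ :=
      (LinearMap.proj (i, i.1) ∘ₗ LinearMap.applyₗ G ∘ₗ (rectRep i).toLinearMap) ∘ₗ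
        (rightIdeal i).subtype
    refine ⟨(show InjMod i from φ), ?_⟩
    funext b
    obtain ⟨l, r⟩ := b
    simp only [AddMonoidHom.coe_mk, ZeroHom.coe_mk]
    split_ifs with hb
    · have hb' := hb
      have hi := i.2
      simp only [injRect, Set.mem_ofPred_eq] at hb'
      change rectRep i (gen (Gen.e i) * monomial n (i.1 - r) (l - r)) G (i, i.1) = F (l, r)
      rw [map_mul, Module.End.mul_apply, rectRep_gen, rectAction_e, if_pos rfl, monomial, map_mul,
        Module.End.mul_apply, rectRep_sumAl_pow i _ (i.1 - r) (l' := ⟨r, by omega⟩) (r' := r)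
        (by simp only; omega) (by omega) (by simp only [injRect, Set.mem_ofPred_eq]; omega),
        rectRep_sumAls_pow i G (l - r) (l' := ⟨l, by omega⟩) (by simp only; omega)
        (by simp only [injRect, Set.mem_ofPred_eq]; omega) hb]
    · exact (hF _ hb).symm
  coord_e m f b := by
    simp only [AddMonoidHom.coe_mk, ZeroHom.coe_mk, evalInj_smul]
    by_cases hb : b ∈ injRect n i
    · have hb' := hb
      simp only [injRect, Set.mem_ofPred_eq] at hb'
      simp only [hb, if_true]
      by_cases hm : b.1 = m.1
      · rw [if_pos hm]
        apply evalInj_congr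
        rw [← mul_assoc, gen_e_mul_monomial_mul_gen_e, if_pos (by omega)]
      · rw [if_neg hm]
        apply evalInj_eq_zero
        rw [← mul_assoc, gen_e_mul_monomial_mul_gen_e, if_neg (by omega)]
    · simp [hb]
  coord_al a f l r hb := by
    have hb' := hb
    simp only [injRect, Set.mem_ofPred_eq] at hb'
    have hb2 : (l, r) ∈ injRect n i := by simp only [injRect, Set.mem_ofPred_eq]; omega
    simp only [AddMonoidHom.coe_mk, ZeroHom.coe_mk, evalInj_smul, hb, hb2, if_true]
    rw [← sumAl_mul_src, ← mul_assoc, monomial_mul_sumAl, show i.1 - (r + 1) + 1 = i.1 - r by omega,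
      show l + 1 - (r + 1) = l - r by omega]
    by_cases hl : l = a.1
    · rw [if_pos hl]
      apply evalInj_congr
      rw [← mul_assoc, gen_e_mul_monomial_mul_gen_e, if_pos (by simp only [src]; omega)]
    · rw [if_neg hl]
      apply evalInj_eq_zero
      rw [← mul_assoc, gen_e_mul_monomial_mul_gen_e, if_neg (by simp only [src]; omega)]
  coord_al_zero a f b hb := by
    simp only [AddMonoidHom.coe_mk, ZeroHom.coe_mk, evalInj_smul]
    split_ifs with h
    · simp only [injRect, Set.mem_ofPred_eq] at h
      apply evalInj_eq_zero
      rw [← sumAl_mul_src, ← mul_assoc (monomial _ _ _), monomial_mul_sumAl, ← mul_assoc,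
        gen_e_mul_monomial_eq_zero (by omega), zero_mul]
    · rfl
  coord_als a f l r hb := by
    have hb' := hb
    simp only [injRect, Set.mem_ofPred_eq] at hb'
    simp only [AddMonoidHom.coe_mk, ZeroHom.coe_mk, evalInj_smul, hb, if_true]
    rw [← sumAls_mul_tgt, ← mul_assoc, monomial_mul_sumAls]
    by_cases hb2 : (l + 1, r) ∈ injRect n i
    · rw [if_pos hb2, show l + 1 - r = l - r + 1 by omega]
      by_cases hl : l = a.1
      · rw [if_pos hl]
        apply evalInj_congr
        rw [← mul_assoc, gen_e_mul_monomial_mul_gen_e, if_pos (by simp only [tgt]; omega)]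
      · rw [if_neg hl]
        apply evalInj_eq_zero
        rw [← mul_assoc, gen_e_mul_monomial_mul_gen_e, if_neg (by simp only [tgt]; omega)]
    · rw [if_neg hb2, ite_self]
      simp only [injRect, Set.mem_ofPred_eq] at hb2
      apply evalInj_eq_zero
      rw [← mul_assoc, gen_e_mul_monomial_eq_zero (by omega), zero_mul]

/-! ### Height functions and the greedy operators -/

/-- The points between two height functions: on the diagonal of the vertex `l` these are the
points `(l, r)` with `f (l + 1) ≤ r < g (l + 1)`. -/
def heightRegion (g f : ℕ → ℕ) : Set (ℕ × ℕ) := {b | f (b.1 + 1) ≤ b.2 ∧ b.2 < g (b.1 + 1)}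

/-- `g` counts the vertical steps of a path with `n` steps, `m` of which are vertical. -/
structure IsHeight (n m : ℕ) (g : ℕ → ℕ) : Prop where
  zero : g 0 = 0
  mono : ∀ p, g p ≤ g (p + 1)
  step : ∀ p, g (p + 1) ≤ g p + 1
  top : ∀ p, n ≤ p → g p = m

/-- Lower the value at `i + 1` by one if this gives the height function of a path. -/
def greedy (g : ℕ → ℕ) (i : ℕ) : ℕ → ℕ :=
  Function.update g (i + 1) (max (g i) (g (i + 2) - 1))

theorem greedy_self (g : ℕ → ℕ) (i : ℕ) : greedy g i (i + 1) = max (g i) (g (i + 2) - 1) := by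
  simp [greedy]

theorem greedy_of_ne (g : ℕ → ℕ) {i p : ℕ} (h : p ≠ i + 1) : greedy g i p = g p := by
  simp [greedy, h]

theorem IsHeight.greedy {n m : ℕ} {g : ℕ → ℕ} (hg : IsHeight n m g) {i : ℕ} (hi : i + 1 < n) :
    IsHeight n m (greedy g i) := by
  have h1 := hg.mono i
  have h2 := hg.mono (i + 1)
  have h3 := hg.step i
  have h4 := hg.step (i + 1)
  rw [show i + 1 + 1 = i + 2 by ring] at h2 h4
  refine ⟨?_, fun p => ?_, fun p => ?_, fun p hp => ?_⟩
  · rw [greedy_of_ne g (by omega), hg.zero]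
  · rcases eq_or_ne p i with rfl | hpi
    · rw [greedy_self, greedy_of_ne g (by omega)]; omega
    · rcases eq_or_ne p (i + 1) with rfl | hpi'
      · rw [greedy_self, greedy_of_ne g (by omega), show i + 1 + 1 = i + 2 by ring]; omega
      · rw [greedy_of_ne g hpi', greedy_of_ne g (by omega)]; exact hg.mono p
  · rcases eq_or_ne p i with rfl | hpi
    · rw [greedy_self, greedy_of_ne g (by omega)]; omega
    · rcases eq_or_ne p (i + 1) with rfl | hpi'
      · rw [greedy_self, greedy_of_ne g (by omega), show i + 1 + 1 = i + 2 by ring]; omega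
      · rw [greedy_of_ne g hpi', greedy_of_ne g (by omega)]; exact hg.step p
  · rw [greedy_of_ne g (by omega), hg.top p hp]

theorem greedy_mono {g g' : ℕ → ℕ} (h : ∀ p, g' p ≤ g p) (i p : ℕ) :
    greedy g' i p ≤ greedy g i p := by
  rcases eq_or_ne p (i + 1) with rfl | hp
  · rw [greedy_self, greedy_self]
    have := h i
    have := h (i + 2)
    omega
  · rw [greedy_of_ne _ hp, greedy_of_ne _ hp]; exact h p

/-- The greedy operators of the letters of a word, the last letter acting first. -/
def greedyWord {n : ℕ} (g : ℕ → ℕ) (z : List (Vtx n)) : ℕ → ℕ :=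
  z.foldr (fun i h => greedy h i.1) g

theorem greedyWord_append {n : ℕ} (g : ℕ → ℕ) (y z : List (Vtx n)) :
    greedyWord g (y ++ z) = greedyWord (greedyWord g z) y := by
  simp [greedyWord]

theorem greedyWord_mono {n : ℕ} {g g' : ℕ → ℕ} (h : ∀ p, g' p ≤ g p) (z : List (Vtx n)) (p : ℕ) :
    greedyWord g' z p ≤ greedyWord g z p := by
  induction z generalizing p with
  | nil => exact h p
  | cons i z ih => exact greedy_mono ih _ _

theorem IsHeight.greedyWord {n m : ℕ} {g : ℕ → ℕ} (hg : IsHeight n m g) (z : List (Vtx n)) :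
    IsHeight n m (greedyWord g z) := by
  induction z with
  | nil => exact hg
  | cons i z ih => exact IsHeight.greedy ih (by have := i.2; omega)

/-- Heights along a path grow by 0 or 1, so the bounds by `f` hold automatically for the possible
successors of a point of the region. Having no successor therefore means `g l ≤ r` and `g (l + 2) ≤
r + 1`, which is the lower bound built into `greedy`. In particular `f` does not change. -/
theorem heightRegion_diff_socBoxes {n m : ℕ} {g f : ℕ → ℕ} (hg : IsHeight n m g)
    (hf : IsHeight n m f) (i : ℕ) :
    heightRegion g f \ socBoxes i (heightRegion g f) = heightRegion (greedy g i) f := by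
  ext ⟨l, r⟩
  simp only [socBoxes, heightRegion, Set.mem_sdiff, Set.mem_ofPred_eq]
  rcases eq_or_ne l i with rfl | hl
  · rw [greedy_self]
    have h1 := hg.mono l
    have h2 := hg.step l
    have h3 := hg.mono (l + 1)
    have h4 := hg.step (l + 1)
    have f1 := hf.mono l
    have f2 := hf.step l
    have f3 := hf.mono (l + 1)
    have f4 := hf.step (l + 1)
    rw [show l + 1 + 1 = l + 2 by ring] at *
    constructor
    · rintro ⟨⟨h5, h6⟩, h7⟩
      refine ⟨h5, ?_⟩
      by_contra hcon
      refine h7 ⟨⟨h5, h6⟩, rfl, by omega, fun l' hl' h8 => ?_⟩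
      subst hl'
      omega
    · rintro ⟨h5, h6⟩
      refine ⟨⟨h5, by omega⟩, ?_⟩
      rintro ⟨-, -, h7, h8⟩
      rcases l with _ | l
      · have := hg.zero
        omega
      · have := h8 l rfl
        omega
  · rw [greedy_of_ne g (by omega)]
    simp only [hl, false_and, and_false, not_false_eq_true, and_true]

theorem remaining_heightRegion {n m : ℕ} {g f : ℕ → ℕ} (hg : IsHeight n m g)
    (hf : IsHeight n m f) (z : List (Vtx n)) :
    remaining (heightRegion g f) z = heightRegion (greedyWord g z) f := by
  induction z with
  | nil => rfl
  | cons i z ih =>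
    rw [remaining, ih, heightRegion_diff_socBoxes (hg.greedyWord z) hf]
    rfl

theorem heightRegion_diff {g g' f : ℕ → ℕ} (h : ∀ p, f p ≤ g' p) :
    heightRegion g f \ heightRegion g' f = heightRegion g g' := by
  ext ⟨l, r⟩
  have := h (l + 1)
  simp only [heightRegion, Set.mem_sdiff, Set.mem_ofPred_eq]
  omega

/-! ### Height functions of subsets and their behaviour under simple reflections -/

theorem vert_succ {n : ℕ} (I : Finset (Fin n)) (p : Fin n) :
    vert I (p.1 + 1) = vert I p.1 + if p ∈ I then 1 else 0 := by
  unfold vert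
  have : I.filter (fun i => i.1 < p.1 + 1) =
      I.filter (fun i => i.1 < p.1) ∪ if p ∈ I then {p} else ∅ := by
    ext i
    split_ifs with h
    · simp only [Finset.mem_filter, Finset.mem_union, Finset.mem_singleton, Fin.ext_iff]
      constructor
      · rintro ⟨h1, h2⟩
        by_cases h3 : i.1 = p.1
        · exact Or.inr h3
        · exact Or.inl ⟨h1, by omega⟩
      · rintro (⟨h1, h2⟩ | h1)
        · exact ⟨h1, by omega⟩
        · exact ⟨by rwa [Fin.ext h1], by omega⟩
    · simp only [Finset.mem_filter, Finset.mem_union, Finset.notMem_empty, or_false]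
      constructor
      · rintro ⟨h1, h2⟩
        refine ⟨h1, ?_⟩
        have : i.1 ≠ p.1 := fun h3 => h (by rwa [← Fin.ext h3])
        omega
      · rintro ⟨h1, h2⟩
        exact ⟨h1, by omega⟩
  rw [this, Finset.card_union_of_disjoint]
  · split_ifs <;> simp
  · split_ifs <;> simp

theorem vert_zero {n : ℕ} (I : Finset (Fin n)) : vert I 0 = 0 := by simp [vert]

theorem vert_of_le {n : ℕ} (I : Finset (Fin n)) {p : ℕ} (h : n ≤ p) : vert I p = I.card := by
  rw [vert, Finset.filter_true_of_mem]
  intro i _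
  have := i.2
  omega

theorem isHeight_vert {n : ℕ} (I : Finset (Fin n)) : IsHeight n I.card (vert I) := by
  refine ⟨vert_zero I, fun p => ?_, fun p => ?_, fun p => vert_of_le I⟩
  · by_cases hp : p < n
    · rw [vert_succ I ⟨p, hp⟩]; simp
    · rw [vert_of_le I (by omega), vert_of_le I (by omega)]
  · by_cases hp : p < n
    · rw [vert_succ I ⟨p, hp⟩]; simp only; split_ifs <;> omega
    · rw [vert_of_le I (by omega), vert_of_le I (by omega)]; omega

theorem vert_initial {n m : ℕ} (hm : m ≤ n) (p : ℕ) : vert (initial n m) p = min p m := by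
  induction p with
  | zero => simp [vert_zero]
  | succ p ih =>
    by_cases hp : p < n
    · rw [vert_succ _ ⟨p, hp⟩, ih]
      simp only [initial, Finset.mem_filter, Finset.mem_univ, true_and]
      split_ifs <;> omega
    · rw [vert_of_le _ (by omega), ← vert_of_le (p := p) _ (by omega), ih]; omega

theorem card_initial {n m : ℕ} (hm : m ≤ n) : (initial n m).card = m := by
  rw [← vert_of_le (p := n) _ le_rfl, vert_initial hm]; omega

/-- The height function of the path above the rectangle of `Q_i`. -/
def topHeight (n m : ℕ) (p : ℕ) : ℕ := min p n - (n - m)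

theorem isHeight_topHeight {n m : ℕ} (hm : m ≤ n) (h : 0 < n) : IsHeight n m (topHeight n m) := by
  refine ⟨?_, fun p => ?_, fun p => ?_, fun p hp => ?_⟩ <;> simp only [topHeight] <;> omega

/-- After `p` steps only `n - p` are left to complete the `m` vertical ones, so `topHeight` is the
least height function. -/
theorem topHeight_le {n m : ℕ} {g : ℕ → ℕ} (hg : IsHeight n m g) (p : ℕ) :
    topHeight n m p ≤ g p := by
  have key : ∀ d p, p + d = n → m ≤ g p + d := by
    intro d
    induction d with
    | zero => intro p hp; rw [hg.top p (by omega)]; omega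
    | succ d ih =>
      intro p hp
      have := ih (p + 1) (by omega)
      have := hg.step p
      omega
  by_cases hp : p ≤ n
  · have := key (n - p) p (by omega)
    simp only [topHeight]; omega
  · rw [hg.top p (by omega)]; simp only [topHeight]; omega

theorem injRect_eq {n i : ℕ} (hi : i + 1 < n) :
    injRect n i = heightRegion (vert (initial n (i + 1))) (topHeight n (i + 1)) := by
  ext ⟨l, r⟩
  simp only [injRect, heightRegion, Set.mem_ofPred_eq, vert_initial (show i + 1 ≤ n by omega),
    topHeight]
  omega

theorem vert_image {n : ℕ} (I : Finset (Fin n)) (σ : Equiv.Perm (Fin n)) (p : ℕ) :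
    vert (I.image σ) p = (I.filter fun i => (σ i).1 < p).card := by
  rw [vert, Finset.filter_image, Finset.card_image_of_injective _ σ.injective]

/-- The smaller of the two elements exchanged by `s_i`. -/
def lo {n : ℕ} (i : Vtx n) : Fin n := ⟨i.1, by omega⟩

/-- The larger of the two elements exchanged by `s_i`. -/
def hi {n : ℕ} (i : Vtx n) : Fin n := ⟨i.1 + 1, by omega⟩

theorem s_eq {n : ℕ} (i : Vtx n) : s i = Equiv.swap (lo i) (hi i) := rfl

theorem s_mul_self {n : ℕ} (i : Vtx n) : s i * s i = 1 := Equiv.swap_mul_self _ _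

theorem s_inv {n : ℕ} (i : Vtx n) : (s i)⁻¹ = s i := Equiv.swap_inv _ _

theorem s_s_apply {n : ℕ} (i : Vtx n) (a : Fin n) : s i (s i a) = a := Equiv.swap_apply_self _ _ _

theorem s_lo {n : ℕ} (i : Vtx n) : s i (lo i) = hi i := Equiv.swap_apply_left _ _

theorem s_hi {n : ℕ} (i : Vtx n) : s i (hi i) = lo i := Equiv.swap_apply_right _ _

theorem lo_lt_hi {n : ℕ} (i : Vtx n) : lo i < hi i := Nat.lt_succ_self i.1

theorem s_apply_val {n : ℕ} (i : Vtx n) (a : Fin n) :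
    (s i a).1 = if a.1 = i.1 then i.1 + 1 else if a.1 = i.1 + 1 then i.1 else a.1 := by
  rw [s_eq, Equiv.swap_apply_def]
  simp only [Fin.ext_iff, lo, hi]
  split_ifs <;> rfl

/-- Exchanging two consecutive steps changes the height only between them. The hypothesis excludes a
horizontal step followed by a vertical one, where the exchange would raise the path instead of
lowering it. -/
theorem vert_image_s {n : ℕ} (I : Finset (Fin n)) (i : Vtx n) (h : hi i ∈ I → lo i ∈ I) :
    vert (I.image (s i)) = greedy (vert I) i.1 := by
  have hne : ∀ p, p ≠ i.1 + 1 → vert (I.image (s i)) p = vert I p := by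
    intro p hp
    rw [vert_image, vert]
    congr 1
    ext a
    simp only [Finset.mem_filter, s_apply_val]
    refine and_congr_right fun _ => ?_
    split_ifs <;> omega
  funext p
  rcases eq_or_ne p (i.1 + 1) with rfl | hp
  · have h1 := vert_succ (I.image (s i)) (lo i)
    have h2 := vert_succ I (lo i)
    have h3 := vert_succ I (hi i)
    have hmem : lo i ∈ I.image (s i) ↔ hi i ∈ I := by
      rw [Finset.mem_image]
      constructor
      · rintro ⟨a, ha, hai⟩
        rwa [← s_lo, ← hai, s_s_apply]
      · intro ha
        exact ⟨_, ha, s_hi i⟩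
    simp only [hmem] at h1
    have e0 : (lo i).1 = i.1 := rfl
    have e1 : (hi i).1 = i.1 + 1 := rfl
    rw [e0, hne i.1 (by omega)] at h1
    rw [e0] at h2
    rw [e1, h2] at h3
    rw [greedy_self, h1, show i.1 + 2 = i.1 + 1 + 1 by ring, h3]
    by_cases hh : hi i ∈ I
    · rw [if_pos hh, if_pos (h hh)]; omega
    · rw [if_neg hh]; split_ifs <;> omega
  · rw [hne p hp, greedy_of_ne _ hp]

/-! ### Lengths and reduced words -/

theorem perm_apply_inv {n : ℕ} (w : Equiv.Perm (Fin n)) (a : Fin n) : w (w⁻¹ a) = a := by simp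

theorem perm_inv_apply {n : ℕ} (w : Equiv.Perm (Fin n)) (a : Fin n) : w⁻¹ (w a) = a := by simp

/-- The inversions of a permutation. -/
def inversions {n : ℕ} (w : Equiv.Perm (Fin n)) : Finset (Fin n × Fin n) :=
  Finset.univ.filter fun p => p.1 < p.2 ∧ w p.2 < w p.1

theorem mem_inversions {n : ℕ} {w : Equiv.Perm (Fin n)} {p : Fin n × Fin n} :
    p ∈ inversions w ↔ p.1 < p.2 ∧ w p.2 < w p.1 := by simp [inversions]

theorem len_eq {n : ℕ} (w : Equiv.Perm (Fin n)) : len w = (inversions w).card := rfl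

theorem len_one (n : ℕ) : len (1 : Equiv.Perm (Fin n)) = 0 := by
  rw [len_eq, Finset.card_eq_zero, Finset.eq_empty_iff_forall_notMem]
  intro p hp
  rw [mem_inversions] at hp
  exact absurd hp.1 (not_lt.2 hp.2.le)

theorem len_inv {n : ℕ} (w : Equiv.Perm (Fin n)) : len w⁻¹ = len w := by
  rw [len_eq, len_eq]
  refine Finset.card_nbij' (fun p => (w⁻¹ p.2, w⁻¹ p.1)) (fun p => (w p.2, w p.1)) ?_ ?_ ?_ ?_
  · intro p hp
    simp only [Finset.mem_coe, mem_inversions] at hp ⊢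
    simpa using hp.symm
  · intro p hp
    simp only [Finset.mem_coe, mem_inversions] at hp ⊢
    simpa using hp.symm
  · intro p _; simp
  · intro p _; simp

theorem len_mul_le {n : ℕ} (x y : Equiv.Perm (Fin n)) : len (x * y) ≤ len x + len y := by
  have : inversions (x * y) ⊆ (inversions x).image (Prod.map ⇑y⁻¹ ⇑y⁻¹) ∪ inversions y := by
    rintro ⟨p, q⟩ h
    rw [mem_inversions] at h
    rw [Finset.mem_union]
    rcases lt_trichotomy (y p) (y q) with h' | h' | h'
    · exact Or.inl (Finset.mem_image.2 ⟨(y p, y q), mem_inversions.2 ⟨h', h.2⟩, by simp⟩)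
    · exact absurd (y.injective h') h.1.ne
    · exact Or.inr (mem_inversions.2 ⟨h.1, h'⟩)
  rw [len_eq, len_eq, len_eq]
  exact (Finset.card_le_card this).trans ((Finset.card_union_le _ _).trans
    (Nat.add_le_add_right Finset.card_image_le _))

/-- If `x` undoes no inversion of `y`, the inversions of `x * y` are those of `y` together with
those of `x` pulled back along `y`. -/
theorem len_mul_of_inversions {n : ℕ} (x y : Equiv.Perm (Fin n))
    (h : ∀ p q, p < q → y q < y p → x (y q) < x (y p)) : len (x * y) = len x + len y := by
  have hinj : Function.Injective (Prod.map ⇑y⁻¹ ⇑y⁻¹) := (y⁻¹).injective.prodMap (y⁻¹).injective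
  have hd : Disjoint ((inversions x).image (Prod.map ⇑y⁻¹ ⇑y⁻¹)) (inversions y) := by
    rw [Finset.disjoint_left]
    rintro _ h1 h2
    obtain ⟨⟨a, b⟩, hab, rfl⟩ := Finset.mem_image.1 h1
    rw [mem_inversions] at hab h2
    simp only [Prod.map_fst, Prod.map_snd, perm_apply_inv] at h2
    exact lt_asymm hab.1 h2.2
  have : inversions (x * y) = (inversions x).image (Prod.map ⇑y⁻¹ ⇑y⁻¹) ∪ inversions y := by
    ext ⟨p, q⟩
    rw [Finset.mem_union]
    constructor
    · intro h
      rw [mem_inversions] at h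
      rcases lt_trichotomy (y p) (y q) with h' | h' | h'
      · exact Or.inl (Finset.mem_image.2 ⟨(y p, y q), mem_inversions.2 ⟨h', h.2⟩, by simp⟩)
      · exact absurd (y.injective h') h.1.ne
      · exact Or.inr (mem_inversions.2 ⟨h.1, h'⟩)
    · rintro (h1 | h1)
      · obtain ⟨⟨a, b⟩, hab, he⟩ := Finset.mem_image.1 h1
        rw [mem_inversions] at hab
        simp only [Prod.map_apply, Prod.mk.injEq] at he
        obtain ⟨rfl, rfl⟩ := he
        rw [mem_inversions]
        simp only [Equiv.Perm.mul_apply, perm_apply_inv]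
        refine ⟨?_, hab.2⟩
        by_contra hle
        have hne : y⁻¹ b ≠ y⁻¹ a := fun h => hab.1.ne' ((y⁻¹).injective h)
        have := h (y⁻¹ b) (y⁻¹ a) (lt_of_le_of_ne (not_lt.1 hle) hne) (by simpa using hab.1)
        simp only [perm_apply_inv] at this
        exact lt_asymm this hab.2
      · rw [mem_inversions] at h1 ⊢
        exact ⟨h1.1, h p q h1.1 h1.2⟩
  rw [len_eq, len_eq, len_eq, this, Finset.card_union_of_disjoint hd,
    Finset.card_image_of_injective _ hinj]

theorem len_s {n : ℕ} (i : Vtx n) : len (s i) = 1 := by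
  rw [len_eq, Finset.card_eq_one]
  refine ⟨(lo i, hi i), ?_⟩
  ext ⟨p, q⟩
  simp only [mem_inversions, Finset.mem_singleton, Prod.mk.injEq, Fin.ext_iff, Fin.lt_def,
    s_apply_val, lo, hi]
  split_ifs <;> omega

theorem len_mul_s_of_lt {n : ℕ} {u : Equiv.Perm (Fin n)} {i : Vtx n} (h : u (lo i) < u (hi i)) :
    len (u * s i) = len u + 1 := by
  rw [len_mul_of_inversions, len_s]
  intro p q hpq hs
  have : p = lo i ∧ q = hi i := by
    simp only [Fin.ext_iff, Fin.lt_def, s_apply_val, lo, hi] at hpq hs ⊢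
    split_ifs at hs <;> omega
  rw [this.1, this.2, s_lo, s_hi]
  exact h

theorem len_mul_s_of_gt {n : ℕ} {u : Equiv.Perm (Fin n)} {i : Vtx n} (h : u (hi i) < u (lo i)) :
    len (u * s i) + 1 = len u := by
  have := len_mul_s_of_lt (u := u * s i) (i := i) (by simpa [s_lo, s_hi] using h)
  rw [mul_assoc, s_mul_self, mul_one] at this
  exact this.symm

theorem len_mul_s_lt_iff {n : ℕ} {u : Equiv.Perm (Fin n)} {i : Vtx n} :
    len (u * s i) < len u ↔ u (hi i) < u (lo i) := by
  rcases lt_trichotomy (u (lo i)) (u (hi i)) with h | h | h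
  · have := len_mul_s_of_lt h
    constructor
    · intro h'; omega
    · intro h'; exact absurd h (not_lt.2 h'.le)
  · exact absurd (u.injective h) (lo_lt_hi i).ne
  · have := len_mul_s_of_gt h
    constructor
    · intro _; exact h
    · intro _; omega

theorem wordProd_append {n : ℕ} (y z : List (Vtx n)) :
    wordProd (y ++ z) = wordProd y * wordProd z := by simp [wordProd]

theorem wordProd_cons {n : ℕ} (i : Vtx n) (z : List (Vtx n)) :
    wordProd (i :: z) = s i * wordProd z := by simp [wordProd]

theorem wordProd_singleton {n : ℕ} (i : Vtx n) : wordProd [i] = s i := by simp [wordProd]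

theorem wordProd_nil (n : ℕ) : wordProd ([] : List (Vtx n)) = 1 := by simp [wordProd]

theorem wordProd_reverse {n : ℕ} (z : List (Vtx n)) : wordProd z.reverse = (wordProd z)⁻¹ := by
  induction z with
  | nil => simp [wordProd]
  | cons i z ih =>
    rw [List.reverse_cons, wordProd_append, ih, wordProd_singleton, wordProd_cons, mul_inv_rev,
      s_inv]

/-- A word whose length is the length of its product. -/
def Reduced {n : ℕ} (z : List (Vtx n)) : Prop := z.length = len (wordProd z)

theorem len_wordProd_le {n : ℕ} (z : List (Vtx n)) : len (wordProd z) ≤ z.length := by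
  induction z with
  | nil => rw [wordProd_nil, len_one]; exact Nat.zero_le _
  | cons i z ih =>
    rw [wordProd_cons, List.length_cons]
    have := len_mul_le (s i) (wordProd z)
    rw [len_s] at this
    omega

theorem Reduced.of_append {n : ℕ} {y z : List (Vtx n)} (h : Reduced (y ++ z)) :
    Reduced y ∧ Reduced z := by
  have h1 := len_wordProd_le y
  have h2 := len_wordProd_le z
  have h3 := len_mul_le (wordProd y) (wordProd z)
  rw [Reduced, wordProd_append, List.length_append] at h
  exact ⟨by rw [Reduced]; omega, by rw [Reduced]; omega⟩

theorem Reduced.lt_of_append_singleton {n : ℕ} {u : List (Vtx n)} {i : Vtx n}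
    (h : Reduced (u ++ [i])) : wordProd u (lo i) < wordProd u (hi i) := by
  by_contra hcon
  have hu := h.of_append.1
  have hne : wordProd u (lo i) ≠ wordProd u (hi i) := fun h =>
    (lo_lt_hi i).ne ((wordProd u).injective h)
  have h1 := len_mul_s_of_gt (lt_of_le_of_ne (not_lt.1 hcon) hne.symm)
  rw [Reduced, wordProd_append, wordProd_singleton, List.length_append, List.length_singleton] at h
  rw [Reduced] at hu
  omega

/-- Each letter acts by `vert_image_s`. Its hypothesis holds because the word is reduced: `u (lo i)
< u (hi i)`, so `u (hi i) < m` forces `u (lo i) < m`. -/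
theorem greedyWord_vert_initial {n : ℕ} (m : ℕ) (z : List (Vtx n)) (hz : Reduced z) :
    greedyWord (vert (initial n m)) z.reverse =
      vert ((initial n m).image ⇑(wordProd z)⁻¹) := by
  induction z using List.reverseRecOn with
  | nil => simp [greedyWord, wordProd_nil]
  | append_singleton u i ih =>
    have hlt := hz.lt_of_append_singleton
    have := ih hz.of_append.1
    rw [List.reverse_append, greedyWord_append, this, wordProd_append, wordProd_singleton,
      mul_inv_rev, s_inv, Equiv.Perm.coe_mul, ← Finset.image_image, vert_image_s]
    · rfl
    · intro h
      obtain ⟨a, ha, hai⟩ := Finset.mem_image.1 h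
      refine Finset.mem_image.2 ⟨wordProd u (lo i), ?_, by simp⟩
      simp only [initial, Finset.mem_filter, Finset.mem_univ, true_and] at ha ⊢
      rw [← hai] at hlt
      simp only [perm_apply_inv, Fin.lt_def] at hlt
      omega

/-! ### The positive distinguished subexpression of a word that ends with a reduced word -/

/-- If all letters to the right have been taken, the quotient still to be spelled is given by the
reduced word `y` followed by the current letter, so that letter shortens it. -/
theorem pds_suffix {n : ℕ} {v : Equiv.Perm (Fin n)} (y z : List (Vtx n)) (h : Reduced (y ++ z))
    (hv : wordProd (y ++ z) = v) : pds v z = z := by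
  induction z generalizing y with
  | nil => rfl
  | cons i z ih =>
    have hz : pds v z = z := ih (y ++ [i]) (by simpa using h) (by simpa using hv)
    have hred : Reduced ((y ++ [i]) ++ z) := by simpa using h
    have hlt := hred.of_append.1.lt_of_append_singleton
    have hvz : v * (wordProd z)⁻¹ = wordProd y * s i := by
      rw [← hv, wordProd_append, wordProd_cons]; group
    rw [pds, hz, if_pos]
    rw [hvz, len_mul_s_lt_iff]
    simpa [s_lo, s_hi] using hlt

/-- Once `v` has been spelled the quotient is the identity, which no letter can shorten. -/
theorem pds_append {n : ℕ} {v : Equiv.Perm (Fin n)} (y z : List (Vtx n)) (h : Reduced z)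
    (hv : wordProd z = v) : pds v (y ++ z) = z := by
  induction y with
  | nil => exact pds_suffix [] z h hv
  | cons i y ih =>
    rw [List.cons_append, pds, ih, if_neg]
    rw [hv, mul_inv_cancel, len_one]
    exact Nat.not_lt_zero _

/-! ### Columnar words -/

/-- The columnar reading order on boxes. -/
def readBefore {n k : ℕ} (b b' : Box n k) : Prop := b.2 < b'.2 ∨ (b.2 = b'.2 ∧ b.1 < b'.1)

instance {n k : ℕ} (b b' : Box n k) : Decidable (readBefore b b') := by
  unfold readBefore; infer_instance

theorem mem_columnarBoxes {n k : ℕ} {μ : Finset (Box n k)} {b : Box n k} :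
    b ∈ columnarBoxes μ ↔ b ∈ μ := by
  obtain ⟨r, c⟩ := b
  simp [columnarBoxes]

theorem pairwise_columnarBoxes {n k : ℕ} (μ : Finset (Box n k)) :
    (columnarBoxes μ).Pairwise readBefore := by
  rw [columnarBoxes, List.pairwise_flatMap]
  constructor
  · intro c _
    apply List.Pairwise.filter
    rw [List.pairwise_map]
    exact (List.pairwise_lt_finRange k).imp fun h => Or.inr ⟨rfl, h⟩
  · refine (List.pairwise_lt_finRange (n - k)).imp ?_
    intro c c' h b hb b' hb'
    simp only [List.mem_filter, List.mem_map] at hb hb'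
    obtain ⟨⟨r, -, rfl⟩, -⟩ := hb
    obtain ⟨⟨r', -, rfl⟩, -⟩ := hb'
    exact Or.inl h

theorem readBefore_irrefl {n k : ℕ} (b : Box n k) : ¬ readBefore b b := by
  simp [readBefore]

theorem readBefore_asymm {n k : ℕ} {b b' : Box n k} (h : readBefore b b') :
    ¬ readBefore b' b := by
  simp only [readBefore, Fin.lt_def, Fin.ext_iff] at *
  omega

theorem nodup_columnarBoxes {n k : ℕ} (μ : Finset (Box n k)) : (columnarBoxes μ).Nodup :=
  (pairwise_columnarBoxes μ).imp fun {a b} h => by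
    rintro rfl
    exact readBefore_irrefl a h

theorem columnarBoxes_filter {n k : ℕ} (μ : Finset (Box n k)) (P : Box n k → Prop)
    [DecidablePred P] :
    (columnarBoxes μ).filter (fun b => decide (P b)) = columnarBoxes (μ.filter P) := by
  simp only [columnarBoxes, List.filter_flatMap, List.filter_filter, Finset.mem_filter]
  congr 1
  funext c
  congr 1
  funext b
  rw [Bool.decide_and, Bool.and_comm]

theorem columnarBoxes_erase_last {n k : ℕ} {μ : Finset (Box n k)} {l : List (Box n k)}
    {b : Box n k} (h : columnarBoxes μ = l ++ [b]) : columnarBoxes (μ.erase b) = l := by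
  have hnd := nodup_columnarBoxes μ
  rw [← Finset.filter_ne', ← columnarBoxes_filter, h, List.filter_append]
  rw [h, List.nodup_append] at hnd
  rw [List.filter_eq_self.2]
  · simp
  · intro a ha
    simpa using hnd.2.2 a ha b (by simp)

/-- The list is sorted by the reading order, so an initial segment is the list of a smaller diagram.
Thus a truncated columnar word is again a diagram word. -/
theorem take_columnarBoxes {n k : ℕ} {μ : Finset (Box n k)} {p : ℕ} {b : Box n k}
    (h : (columnarBoxes μ)[p]? = some b) :
    (columnarBoxes μ).take (p + 1) = columnarBoxes (μ.filter fun q => ¬ readBefore b q) := by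
  have hpw := pairwise_columnarBoxes μ
  rw [← columnarBoxes_filter]
  obtain ⟨hp, hb⟩ := List.getElem?_eq_some_iff.1 h
  have hl : columnarBoxes μ = (columnarBoxes μ).take p ++ b :: (columnarBoxes μ).drop (p + 1) := by
    rw [← hb, List.cons_getElem_drop_succ, List.take_append_drop]
  have htake : (columnarBoxes μ).take (p + 1) = (columnarBoxes μ).take p ++ [b] := by
    rw [List.take_add_one, h]; rfl
  generalize (columnarBoxes μ).take p = l₁ at *
  generalize (columnarBoxes μ).drop (p + 1) = l₂ at *
  rw [htake]
  rw [hl] at hpw ⊢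
  rw [List.pairwise_append, List.pairwise_cons] at hpw
  obtain ⟨-, ⟨h2, -⟩, h3⟩ := hpw
  rw [List.filter_append, List.filter_cons, if_pos (by simpa using readBefore_irrefl b),
    List.filter_eq_self.2, List.filter_eq_nil_iff.2]
  · intro a ha
    simpa using h2 a ha
  · intro a ha
    simpa using readBefore_asymm (h3 a ha b (by simp))

/-- `μ` is the Young diagram with column heights `h`. -/
structure IsYoung {n k : ℕ} (μ : Finset (Box n k)) (h : Fin (n - k) → ℕ) : Prop where
  anti : ∀ c c', c ≤ c' → h c' ≤ h c
  le : ∀ c, h c ≤ k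
  mem : ∀ b, b ∈ μ ↔ b.1.1 < h b.2

/-- The word of a diagram, to be multiplied from right to left. -/
def diagramWord {n k : ℕ} (μ : Finset (Box n k)) : List (Vtx n) :=
  ((columnarBoxes μ).map boxLabel).reverse

/-- The images of a permutation given by a Young diagram with column heights `h`. -/
structure IsColumnar {n k : ℕ} (π : Equiv.Perm (Fin n)) (h : Fin (n - k) → ℕ) : Prop where
  right : ∀ (a : Fin n) (c : Fin (n - k)), a.1 = k + c.1 → (π a).1 + h c = k + c.1
  left : ∀ a : Fin n, a.1 < k →
    (π a).1 = a.1 + (Finset.univ.filter fun c : Fin (n - k) => k ≤ a.1 + h c).card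

theorem card_filter_lt {m : ℕ} (c : Fin m) :
    (Finset.univ.filter fun c' : Fin m => c' < c).card = c.1 := by
  rw [Finset.filter_gt_eq_Iio, Fin.card_Iio]

/-- Before the box `(r, c)` is added, the points `k - 1 - r` and `k + c` are sent to the two values
exchanged by its label, in increasing order. The reflection therefore lengthens the row and the
column of the box by one and raises the length. -/
theorem isColumnar_step {n k : ℕ} (hk : k < n) {π : Equiv.Perm (Fin n)} {h : Fin (n - k) → ℕ}
    {r : Fin k} {c : Fin (n - k)} (hc : h c = r.1 + 1) (hlt : ∀ c' < c, r.1 + 1 ≤ h c')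
    (hgt : ∀ c', c < c' → h c' = 0)
    (hπ : IsColumnar π (Function.update h c r.1)) :
    IsColumnar (s (boxLabel (r, c)) * π) h ∧
      π⁻¹ (lo (boxLabel (r, c))) < π⁻¹ (hi (boxLabel (r, c))) := by
  have hr := r.2
  have hcn := c.2
  set i : Vtx n := boxLabel (r, c) with hidef
  have hi' : i.1 = k - 1 - r.1 + c.1 := rfl
  let x : Fin n := ⟨k + c.1, by omega⟩
  let y : Fin n := ⟨k - 1 - r.1, by omega⟩
  have hx : π x = hi i := by
    have := hπ.right x c rfl
    rw [Function.update_self] at this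
    apply Fin.ext
    simp only [hi]; omega
  have hy : π y = lo i := by
    have h1 := hπ.left y (by simp only [y]; omega)
    have h2 : (Finset.univ.filter fun c' : Fin (n - k) =>
        k ≤ y.1 + Function.update h c r.1 c') = Finset.univ.filter fun c' => c' < c := by
      apply Finset.filter_congr
      intro c' _
      rcases lt_trichotomy c' c with h3 | rfl | h3
      · have := hlt c' h3
        rw [Function.update_of_ne h3.ne]
        simp only [h3, iff_true, y]; omega
      · rw [Function.update_self]
        simp only [lt_self_iff_false, iff_false, y]; omega
      · have := hgt c' h3
        rw [Function.update_of_ne h3.ne']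
        simp only [not_lt.2 h3.le, iff_false, y]; omega
    rw [h2, card_filter_lt] at h1
    apply Fin.ext
    have hy1 : y.1 = k - 1 - r.1 := rfl
    change (π y).1 = i.1
    omega
  have hfix : ∀ a, a ≠ x → a ≠ y → s i (π a) = π a := by
    intro a h1 h2
    rw [s_eq, Equiv.swap_apply_of_ne_of_ne]
    · rw [← hy]; exact fun h => h2 (π.injective h)
    · rw [← hx]; exact fun h => h1 (π.injective h)
  refine ⟨⟨?_, ?_⟩, ?_⟩
  · intro a c' ha
    rw [Equiv.Perm.mul_apply]
    rcases eq_or_ne c' c with rfl | hcc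
    · have : a = x := Fin.ext ha
      rw [this, hx, s_hi, hc]
      simp only [lo]; omega
    · have h1 : a ≠ x := fun h => hcc (Fin.ext (by rw [h] at ha; simp only [x] at ha; omega))
      have h2 : a ≠ y := fun h => by rw [h] at ha; simp only [y] at ha; omega
      rw [hfix a h1 h2]
      have := hπ.right a c' ha
      rwa [Function.update_of_ne hcc] at this
  · intro a ha
    rw [Equiv.Perm.mul_apply]
    have h1 : a ≠ x := fun h => by rw [h] at ha; simp only [x] at ha; omega
    by_cases h2 : a = y
    · have h3 : (Finset.univ.filter fun c' : Fin (n - k) => k ≤ a.1 + h c') =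
          insert c (Finset.univ.filter fun c' => c' < c) := by
        ext c'
        simp only [Finset.mem_filter, Finset.mem_univ, true_and, Finset.mem_insert, h2]
        rcases lt_trichotomy c' c with h3 | rfl | h3
        · have := hlt c' h3
          simp only [h3, or_true, iff_true, y]; omega
        · simp only [true_or, iff_true, y]; omega
        · have := hgt c' h3
          simp only [h3.ne', not_lt.2 h3.le, or_self, iff_false, y]; omega
      rw [h3, Finset.card_insert_of_notMem (by simp), card_filter_lt, h2, hy, s_lo]
      simp only [hi, y]; omega
    · rw [hfix a h1 h2, hπ.left a ha]
      congr 2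
      apply Finset.filter_congr
      intro c' _
      rcases eq_or_ne c' c with rfl | hcc
      · have : a.1 ≠ k - 1 - r.1 := fun h => h2 (Fin.ext h)
        rw [Function.update_self]; omega
      · rw [Function.update_of_ne hcc]
  · rw [← hy, ← hx, perm_inv_apply, perm_inv_apply, Fin.lt_def]
    simp only [x, y]; omega

theorem isColumnar_one {n k : ℕ} {h : Fin (n - k) → ℕ} (h0 : ∀ c, h c = 0) :
    IsColumnar (1 : Equiv.Perm (Fin n)) h := by
  refine ⟨fun a c ha => ?_, fun a ha => ?_⟩
  · rw [h0]; exact ha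
  · simp only [Equiv.Perm.one_apply, h0, add_zero, not_le.2 ha, Finset.filter_false,
      Finset.card_empty]

/-- The box read last is the bottom box of the last nonempty column, so removing it leaves a Young
diagram. -/
theorem IsYoung.eraseLast {n k : ℕ} {μ : Finset (Box n k)} {h : Fin (n - k) → ℕ}
    (hμ : IsYoung μ h) {r : Fin k} {c : Fin (n - k)} (hb : (r, c) ∈ μ)
    (hlast : ∀ q ∈ μ, ¬ readBefore (r, c) q) :
    h c = r.1 + 1 ∧ (∀ c' < c, r.1 + 1 ≤ h c') ∧ (∀ c', c < c' → h c' = 0) ∧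
      IsYoung (μ.erase (r, c)) (Function.update h c r.1) := by
  have hr := r.2
  have h1 : r.1 < h c := (hμ.mem (r, c)).1 hb
  have hc : h c = r.1 + 1 := by
    by_contra hne
    have hle := hμ.le c
    exact hlast (⟨r.1 + 1, by omega⟩, c) ((hμ.mem _).2 (by simp only; omega))
      (Or.inr ⟨rfl, by simp [Fin.lt_def]⟩)
  have hlt : ∀ c' < c, r.1 + 1 ≤ h c' := fun c' hc' => by
    have := hμ.anti c' c hc'.le; omega
  have hgt : ∀ c', c < c' → h c' = 0 := fun c' hc' => by
    by_contra hne
    exact hlast (⟨0, by omega⟩, c') ((hμ.mem _).2 (Nat.pos_of_ne_zero hne)) (Or.inl hc')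
  refine ⟨hc, hlt, hgt, ?_, ?_, ?_⟩
  · intro c₁ c₂ h12
    have := hμ.anti c₁ c₂ h12
    rcases eq_or_ne c₁ c with rfl | h3 <;> rcases eq_or_ne c₂ c₁ with rfl | h4
    · exact le_rfl
    · rw [Function.update_of_ne h4, Function.update_self,
        hgt c₂ (lt_of_le_of_ne h12 h4.symm)]
      exact Nat.zero_le _
    · exact le_rfl
    · rw [Function.update_of_ne h3]
      rcases eq_or_ne c₂ c with rfl | h5
      · rw [Function.update_self]; omega
      · rwa [Function.update_of_ne h5]
  · intro c'
    rcases eq_or_ne c' c with rfl | h3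
    · rw [Function.update_self]; omega
    · rw [Function.update_of_ne h3]; exact hμ.le c'
  · rintro ⟨r', c'⟩
    rw [Finset.mem_erase, hμ.mem]
    rcases eq_or_ne c' c with rfl | h3
    · simp only [Function.update_self, ne_eq, Prod.mk.injEq, and_true, Fin.ext_iff]; omega
    · simp [h3]

theorem diagramWord_spec {n k : ℕ} (hk : k < n) (N : ℕ) (μ : Finset (Box n k))
    (h : Fin (n - k) → ℕ) (hμ : IsYoung μ h) (hN : μ.card = N) :
    IsColumnar (wordProd (diagramWord μ)) h ∧ Reduced (diagramWord μ) := by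
  induction N generalizing μ h with
  | zero =>
    rw [Finset.card_eq_zero] at hN
    have hnil : columnarBoxes μ = [] := by
      rw [List.eq_nil_iff_forall_not_mem]
      intro b hb
      rw [mem_columnarBoxes, hN] at hb
      simp at hb
    have hw : diagramWord μ = [] := by simp [diagramWord, hnil]
    rw [hw, wordProd_nil]
    refine ⟨isColumnar_one fun c => ?_, by simp [Reduced, wordProd_nil, len_one]⟩
    by_contra hne
    have hle := hμ.le c
    have : ((⟨0, by omega⟩, c) : Box n k) ∈ μ := (hμ.mem _).2 (Nat.pos_of_ne_zero hne)
    rw [hN] at this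
    simp at this
  | succ N ih =>
    have hne : columnarBoxes μ ≠ [] := by
      obtain ⟨b, hb⟩ := Finset.card_pos.1 (by omega : 0 < μ.card)
      exact List.ne_nil_of_mem (mem_columnarBoxes.2 hb)
    obtain ⟨l, ⟨r, c⟩, hl⟩ : ∃ l b, columnarBoxes μ = l ++ [b] :=
      ⟨_, _, (List.dropLast_append_getLast hne).symm⟩
    have hb : (r, c) ∈ μ := mem_columnarBoxes.1 (by rw [hl]; simp)
    have hlast : ∀ q ∈ μ, ¬ readBefore (r, c) q := by
      intro q hq
      have hpw := pairwise_columnarBoxes μ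
      rw [← mem_columnarBoxes, hl, List.mem_append, List.mem_singleton] at hq
      rw [hl, List.pairwise_append] at hpw
      rcases hq with hq | rfl
      · exact readBefore_asymm (hpw.2.2 q hq _ (by simp))
      · exact readBefore_irrefl _
    obtain ⟨h1, h2, h3, h4⟩ := hμ.eraseLast hb hlast
    obtain ⟨h5, h6⟩ := ih (μ.erase (r, c)) _ h4 (by rw [Finset.card_erase_of_mem hb, hN]; rfl)
    obtain ⟨h7, h8⟩ := isColumnar_step hk h1 h2 h3 h5
    have hw : diagramWord μ = boxLabel (r, c) :: diagramWord (μ.erase (r, c)) := by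
      simp [diagramWord, columnarBoxes_erase_last hl, hl]
    rw [hw, wordProd_cons]
    refine ⟨h7, ?_⟩
    have := len_mul_s_of_lt h8
    rw [Reduced] at h6 ⊢
    rw [List.length_cons, wordProd_cons, h6, ← len_inv, ← len_inv (s _ * _), mul_inv_rev, s_inv,
      this]

theorem vert_add_hor {n : ℕ} (I : Finset (Fin n)) {p : ℕ} (hp : p ≤ n) :
    vert I p + hor I p = p := by
  rw [hor]
  change vert I p + vert Iᶜ p = p
  induction p with
  | zero => simp [vert_zero]
  | succ p ih =>
    have := ih (by omega)
    rw [vert_succ I ⟨p, hp⟩, vert_succ Iᶜ ⟨p, hp⟩]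
    simp only [Finset.mem_compl]
    split_ifs <;> omega

theorem vert_mono {n : ℕ} (I : Finset (Fin n)) {p q : ℕ} (h : p ≤ q) : vert I p ≤ vert I q :=
  monotone_nat_of_le_succ (isHeight_vert I).mono h

theorem hor_mono {n : ℕ} (I : Finset (Fin n)) {p q : ℕ} (h : p ≤ q) : hor I p ≤ hor I q :=
  vert_mono Iᶜ h

theorem vert_le_card {n : ℕ} (I : Finset (Fin n)) (p : ℕ) : vert I p ≤ I.card :=
  Finset.card_filter_le _ _

/-- The horizontal steps are labelled by the increasing values `g k, g (k + 1), …`. -/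
theorem hor_image_initial {n k : ℕ} {g : Equiv.Perm (Fin n)}
    (hg : ∀ a b : Fin n, a < b → (a.1 < k ↔ b.1 < k) → g a < g b) (a : Fin n) (ha : k ≤ a.1) :
    hor ((initial n k).image g) (g a).1 = a.1 - k := by
  have hcompl : ((initial n k).image g)ᶜ = (initial n k)ᶜ.image g := by
    ext b
    simp only [Finset.mem_compl, Finset.mem_image, not_exists, not_and]
    constructor
    · intro h
      exact ⟨g⁻¹ b, fun h' => h _ h' (perm_apply_inv g b), perm_apply_inv g b⟩
    · rintro ⟨c, hc, rfl⟩ d hd hdc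
      exact hc (g.injective hdc ▸ hd)
  have : hor ((initial n k).image g) (g a).1 = vert ((initial n k)ᶜ.image g) (g a).1 := by
    rw [← hcompl]; rfl
  rw [this, vert_image]
  have hset : ((initial n k)ᶜ.filter fun i => (g i).1 < (g a).1) =
      Finset.Ico ⟨k, lt_of_le_of_lt ha a.2⟩ a := by
    ext b
    simp only [initial, Finset.mem_filter, Finset.mem_compl, Finset.mem_univ, true_and,
      Finset.mem_Ico, Fin.le_def, not_lt]
    refine and_congr_right fun hb => ?_
    constructor
    · intro h
      by_contra hba
      rcases eq_or_lt_of_le (not_lt.1 hba) with rfl | hab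
      · omega
      · have := hg a b hab (by omega)
        rw [Fin.lt_def] at this
        omega
    · intro h
      exact hg b a h (by omega)
  rw [hset, Fin.card_Ico]

/-- Column `c` lies above the horizontal step labelled by `g (k + c)`; its height is `k` minus the
number of vertical steps taken before. -/
theorem isYoung_partNE {n k : ℕ} (hk : k < n) {g : Equiv.Perm (Fin n)}
    (hg : ∀ a b : Fin n, a < b → (a.1 < k ↔ b.1 < k) → g a < g b) :
    IsYoung (partNE k ((initial n k).image g))
      (fun c => k - vert ((initial n k).image g) (g ⟨k + c.1, by omega⟩).1) := by
  set I := (initial n k).image g with hI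
  have hcard : I.card = k := by
    rw [hI, Finset.card_image_of_injective _ g.injective, card_initial hk.le]
  refine ⟨?_, fun c => Nat.sub_le _ _, ?_⟩
  · intro c c' hcc
    apply Nat.sub_le_sub_left
    apply vert_mono
    rcases eq_or_lt_of_le hcc with rfl | hlt
    · exact le_rfl
    · exact (hg ⟨k + c.1, by omega⟩ ⟨k + c'.1, by omega⟩ (Nat.add_lt_add_left hlt k)
        (by simp only; omega)).le
  · rintro ⟨r, c⟩
    let a : Fin n := ⟨k + c.1, by omega⟩
    have hr := r.2
    have h1 : hor I (g a).1 = c.1 := by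
      rw [hI, hor_image_initial hg a (Nat.le_add_right k c.1)]
      exact Nat.add_sub_cancel_left k c.1
    have h2 := vert_add_hor I (p := (g a).1) (by omega)
    have hna : g a ∉ I := by
      rw [hI, Finset.mem_image]
      rintro ⟨b, hb, hba⟩
      rw [g.injective hba] at hb
      simp [initial, a] at hb
    have h3 := vert_succ I (g a)
    rw [if_neg hna] at h3
    have h4 := vert_add_hor I (p := (g a).1 + 1) (by omega)
    simp only [partNE, Finset.mem_filter, Finset.mem_univ, true_and]
    change _ ↔ r.1 < k - vert I (g a).1
    constructor
    · rintro ⟨p, hp1, hp2⟩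
      have : (g a).1 ≤ p.1 := by
        by_contra hcon
        have := hor_mono I (not_le.1 hcon).le
        omega
      have := vert_mono I this
      omega
    · intro h
      exact ⟨⟨(g a).1 + 1, by omega⟩, by simp only; omega, by simp only; omega⟩

/-- The product of the word agrees with `g` on the points from `k` on, by counting steps, and both
are increasing below `k`. This determines the permutation. -/
theorem columnarWord_spec {n k : ℕ} (hk : k < n) {g : Equiv.Perm (Fin n)}
    (hg : ∀ a b : Fin n, a < b → (a.1 < k ↔ b.1 < k) → g a < g b) :
    wordProd (columnarWord k g) = g ∧ Reduced (columnarWord k g) := by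
  have hμ := isYoung_partNE hk hg
  obtain ⟨h1, h2⟩ := diagramWord_spec hk _ _ _ hμ rfl
  refine ⟨?_, h2⟩
  change wordProd (diagramWord _) = g
  set π := wordProd (diagramWord (partNE k ((initial n k).image g))) with hπ
  have hright : ∀ a : Fin n, k ≤ a.1 → π a = g a := by
    intro a ha
    have h3 := h1.right a ⟨a.1 - k, by omega⟩ (by simp only; omega)
    have h4 := hor_image_initial hg a ha
    have h5 := vert_add_hor ((initial n k).image g) (p := (g a).1) (by omega)
    have h6 := vert_le_card ((initial n k).image g) (g a).1
    rw [Finset.card_image_of_injective _ g.injective, card_initial hk.le] at h6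
    have ha' : (⟨k + (a.1 - k), by omega⟩ : Fin n) = a := Fin.ext (by simp only; omega)
    simp only [ha'] at h3
    apply Fin.ext
    omega
  have hleft : ∀ a b : Fin n, a < b → b.1 < k → π a < π b := by
    intro a b hab hb
    rw [Fin.lt_def] at hab ⊢
    rw [h1.left a (by omega), h1.left b hb]
    have : (Finset.univ.filter fun c : Fin (n - k) => k ≤ a.1 +
        (k - vert ((initial n k).image g) (g ⟨k + c.1, by omega⟩).1)).card ≤
      (Finset.univ.filter fun c : Fin (n - k) => k ≤ b.1 +
        (k - vert ((initial n k).image g) (g ⟨k + c.1, by omega⟩).1)).card := by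
      apply Finset.card_le_card
      intro c
      simp only [Finset.mem_filter, Finset.mem_univ, true_and]
      omega
    omega
  -- The quotient of the two permutations is strictly increasing, hence the identity.
  let τ : Equiv.Perm (Fin n) := g⁻¹ * π
  have hgτ : ∀ a, g (τ a) = π a := fun a => perm_apply_inv g _
  have hτr : ∀ a : Fin n, k ≤ a.1 → τ a = a := fun a ha => by
    apply g.injective
    rw [hgτ, hright a ha]
  have hτl : ∀ a : Fin n, a.1 < k → (τ a).1 < k := by
    intro a ha
    by_contra hcon
    have := τ.injective (hτr (τ a) (not_lt.1 hcon))
    rw [this] at hcon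
    exact hcon ha
  have hmono : StrictMono τ := by
    intro a b hab
    by_cases hb : b.1 < k
    · have ha : a.1 < k := lt_trans hab hb
      have h3 := hleft a b hab hb
      rw [← hgτ, ← hgτ] at h3
      by_contra hcon
      rcases eq_or_lt_of_le (not_lt.1 hcon) with h | h
      · rw [h] at h3; exact lt_irrefl _ h3
      · exact lt_asymm h3 (hg _ _ h (by have := hτl a ha; have := hτl b hb; omega))
    · rw [hτr b (not_lt.1 hb)]
      by_cases ha : a.1 < k
      · have := hτl a ha
        rw [Fin.lt_def]; omega
      · rwa [hτr a (not_lt.1 ha)]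
  have hid : ⇑τ = id := (hmono.range_inj strictMono_id).1 (by
    rw [τ.surjective.range_eq, Set.range_id])
  ext a
  rw [← hgτ, hid]; rfl

theorem columnarWord'_eq {n : ℕ} (k : ℕ) (y : Equiv.Perm (Fin n)) :
    columnarWord' k y = (columnarWord k y⁻¹).reverse := by
  simp [columnarWord', columnarWord]

theorem Reduced.reverse {n : ℕ} {z : List (Vtx n)} (h : Reduced z) : Reduced z.reverse := by
  rw [Reduced, List.length_reverse, wordProd_reverse, len_inv]
  exact h

/-! ### Maximal coset representatives and length-additive factorisations -/

theorem len_s_mul_le_iff {n : ℕ} {u : Equiv.Perm (Fin n)} {i : Vtx n} :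
    len (s i * u) ≤ len u ↔ u⁻¹ (hi i) < u⁻¹ (lo i) := by
  rw [← len_inv (s i * u), ← len_inv u, mul_inv_rev, s_inv]
  rcases lt_trichotomy (u⁻¹ (lo i)) (u⁻¹ (hi i)) with h | h | h
  · have := len_mul_s_of_lt h
    constructor
    · intro h'; omega
    · intro h'; exact absurd h (not_lt.2 h'.le)
  · exact absurd ((u⁻¹).injective h) (lo_lt_hi i).ne
  · have := len_mul_s_of_gt h
    constructor
    · intro _; exact h
    · intro _; omega

theorem s_mem_WK {n k : ℕ} {i : Vtx n} (h : i.1 + 1 ≠ k) : s i ∈ WK n k :=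
  Subgroup.subset_closure ⟨i, h, rfl⟩

theorem WK_apply_lt_iff {n k : ℕ} {u : Equiv.Perm (Fin n)} (hu : u ∈ WK n k) (a : Fin n) :
    (u a).1 < k ↔ a.1 < k := by
  induction hu using Subgroup.closure_induction generalizing a with
  | mem g hg =>
    obtain ⟨i, hi, rfl⟩ := hg
    rw [s_apply_val]
    split_ifs <;> omega
  | one => rfl
  | mul g h _ _ hg hh => rw [Equiv.Perm.mul_apply, hg, hh]
  | inv g _ hg => rw [← hg (g⁻¹ a), perm_apply_inv]

/-- A relation between the values at neighbours in the same block holds for all pairs in a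
block. -/
theorem lt_of_block {n k : ℕ} {R : Fin n → Fin n → Prop} [IsTrans (Fin n) R]
    {f : Fin n → Fin n} (h : ∀ i : Vtx n, i.1 + 1 ≠ k → R (f (lo i)) (f (hi i)))
    {a b : Fin n} (hab : a < b) (hk : a.1 < k ↔ b.1 < k) : R (f a) (f b) := by
  obtain ⟨a, ha⟩ := a
  obtain ⟨b, hb⟩ := b
  simp only [Fin.mk_lt_mk] at hab hk
  induction b, hab using Nat.le_induction with
  | base => exact h ⟨a, by omega⟩ (by simp only; omega)
  | succ b hab ih =>
    exact _root_.trans (ih (by omega) (by omega)) (h ⟨b, by omega⟩ (by simp only; omega))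

/-- Maximality in the coset gives a descent of `v⁻¹` at each `s_i` in `W_K`, and these chain
together within a block. -/
theorem WKmax_inv_lt {n k : ℕ} {v : Equiv.Perm (Fin n)} (hv : v ∈ WKmax n k) {a b : Fin n}
    (hab : a < b) (hk : a.1 < k ↔ b.1 < k) : v⁻¹ b < v⁻¹ a :=
  lt_of_block (R := fun x y => y < x) (f := ⇑v⁻¹)
    (fun _ hi => len_s_mul_le_iff.1 (hv _ (s_mem_WK hi))) hab hk

theorem longest_inv_lt {n k : ℕ} {w : Equiv.Perm (Fin n)} (hw : IsLongestWK k w) {a b : Fin n}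
    (hab : a < b) (hk : a.1 < k ↔ b.1 < k) : w⁻¹ b < w⁻¹ a :=
  lt_of_block (R := fun x y => y < x) (f := ⇑w⁻¹)
    (fun _ hi => len_s_mul_le_iff.1 (hw.2 _ (mul_mem (s_mem_WK hi) hw.1))) hab hk

theorem longest_lt {n k : ℕ} {w : Equiv.Perm (Fin n)} (hw : IsLongestWK k w) {a b : Fin n}
    (hab : a < b) (hk : a.1 < k ↔ b.1 < k) : w b < w a := by
  by_contra hcon
  have h1 := WK_apply_lt_iff hw.1 a
  have h2 := WK_apply_lt_iff hw.1 b
  have hne : w a ≠ w b := fun h => hab.ne (w.injective h)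
  have := longest_inv_lt hw (lt_of_le_of_ne (not_lt.1 hcon) hne) (by omega)
  rw [perm_inv_apply, perm_inv_apply] at this
  exact lt_asymm hab this

/-- Here `v'⁻¹` is `(w * v')⁻¹` composed with `w`: both reverse the order on each block, and `w`
preserves the blocks. -/
theorem minimal_inv_lt {n k : ℕ} {w v' : Equiv.Perm (Fin n)} (hw : IsLongestWK k w)
    (hv : w * v' ∈ WKmax n k) {a b : Fin n} (hab : a < b) (hk : a.1 < k ↔ b.1 < k) :
    v'⁻¹ a < v'⁻¹ b := by
  have h1 := WK_apply_lt_iff hw.1 a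
  have h2 := WK_apply_lt_iff hw.1 b
  have := WKmax_inv_lt hv (longest_lt hw hab hk) (by omega)
  simpa [mul_inv_rev] using this

/-- Inversions of `v'` have values in different blocks, and `w` cannot reverse the order of such
values. -/
theorem len_longest_mul {n k : ℕ} {w v' : Equiv.Perm (Fin n)} (hw : IsLongestWK k w)
    (hv : w * v' ∈ WKmax n k) : len (w * v') = len w + len v' := by
  apply len_mul_of_inversions
  intro p q hpq hlt
  have h1 := WK_apply_lt_iff hw.1 (v' p)
  have h2 := WK_apply_lt_iff hw.1 (v' q)
  by_cases hk : (v' q).1 < k ↔ (v' p).1 < k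
  · have := minimal_inv_lt hw hv hlt hk
    rw [perm_inv_apply, perm_inv_apply] at this
    exact absurd hpq (lt_asymm this)
  · rw [Fin.lt_def] at hlt ⊢
    omega

/-- If `x` had a descent at some `s_i` in `W_K`, then `x * s i` and `s i * v` would both be shorter,
and their product `x * v` would be too short. -/
theorem left_factor_lt {n k : ℕ} {x v : Equiv.Perm (Fin n)} (hv : v ∈ WKmax n k)
    (hlen : len (x * v) = len x + len v) {a b : Fin n} (hab : a < b) (hk : a.1 < k ↔ b.1 < k) :
    x a < x b := by
  refine lt_of_block (R := fun x y => x < y) (f := ⇑x) (fun i hik => ?_) hab hk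
  by_contra hcon
  have hne : x (lo i) ≠ x (hi i) := fun h => (lo_lt_hi i).ne (x.injective h)
  have h1 := len_mul_s_of_gt (lt_of_le_of_ne (not_lt.1 hcon) hne.symm)
  have h2 := len_s_mul_le_iff.1 (hv _ (s_mem_WK hik))
  have h3 := len_mul_s_of_gt h2
  rw [← s_inv i, ← mul_inv_rev, len_inv, len_inv] at h3
  have h4 := len_mul_le (x * s i) (s i * v)
  rw [mul_assoc, ← mul_assoc (s i), s_mul_self, one_mul] at h4
  omega

theorem standard_factor {n k : ℕ} (hkn : k < n) {w v' : Equiv.Perm (Fin n)}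
    {ks : List (Vtx n)} (hw : IsLongestWK k w) (hv : w * v' ∈ WKmax n k)
    (hks : IsReducedWord ks w) :
    wordProd (ks ++ columnarWord' k v') = w * v' ∧ Reduced (ks ++ columnarWord' k v') := by
  obtain ⟨h1, h2⟩ := columnarWord_spec hkn (g := v'⁻¹) fun a b => minimal_inv_lt hw hv
  have h3 : wordProd (columnarWord' k v') = v' := by
    rw [columnarWord'_eq, wordProd_reverse, h1, inv_inv]
  have h4 : Reduced (columnarWord' k v') := by
    rw [columnarWord'_eq]; exact h2.reverse
  have h5 : wordProd (ks ++ columnarWord' k v') = w * v' := by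
    rw [wordProd_append, hks.1, h3]
  refine ⟨h5, ?_⟩
  rw [Reduced, h3] at h4
  rw [Reduced, h5, List.length_append, len_longest_mul hw hv, hks.2, h4]

/-! ### Diagrams of the truncated words -/

/-- The preimage of `[l]`, for `s_l` the entry of `b`, under the permutation of the boxes of a diagram
that are read up to `b`. -/
def Aset {n k : ℕ} (b : Box n k) : Finset (Fin n) :=
  Finset.univ.filter fun a => a.1 + 1 + b.1.1 < k ∨ (k ≤ a.1 ∧ a.1 ≤ k + b.2.1)

theorem mem_Aset {n k : ℕ} (b : Box n k) (a : Fin n) :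
    a ∈ Aset b ↔ a.1 + 1 + b.1.1 < k ∨ (k ≤ a.1 ∧ a.1 ≤ k + b.2.1) := by simp [Aset]

theorem mem_initial {n k : ℕ} (a : Fin n) : a ∈ initial n k ↔ a.1 < k := by simp [initial]

theorem mem_Jset {n k : ℕ} (b : Box n k) (a : Fin n) :
    a ∈ Jset b ↔ a.1 + 1 + b.1.1 < k ∨ (k + b.2.1 ≤ a.1 + b.1.1 ∧ a.1 ≤ k + b.2.1) := by
  obtain ⟨r, c⟩ := b
  have hr := r.2
  have hc := c.2
  have hcard : ∀ r' : Fin k, ((rect (r, c)).filter fun b => b.1 = r').card =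
      if r' ≤ r then c.1 + 1 else 0 := by
    intro r'
    split_ifs with h
    · have : (rect (r, c)).filter (fun b => b.1 = r') =
          (Finset.Iic c).map ⟨fun c' => (r', c'), fun _ _ h => (Prod.mk.inj h).2⟩ := by
        ext ⟨r₁, c₁⟩
        simp only [rect, Finset.mem_filter, Finset.mem_univ, true_and, Finset.mem_map,
          Finset.mem_Iic]
        constructor
        · rintro ⟨⟨-, h2⟩, rfl⟩
          exact ⟨c₁, h2, rfl⟩
        · rintro ⟨c₂, h2, h3⟩
          obtain ⟨rfl, rfl⟩ := Prod.mk.inj h3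
          exact ⟨⟨h, h2⟩, rfl⟩
      rw [this, Finset.card_map, Fin.card_Iic]
    · rw [Finset.card_eq_zero, Finset.filter_eq_empty_iff]
      rintro ⟨r₁, c₁⟩ h1 rfl
      simp only [rect, Finset.mem_filter, Finset.mem_univ, true_and] at h1
      exact h h1.1
  simp only [Jset, vertNE, Finset.mem_filter, Finset.mem_univ, true_and, hcard, Fin.le_def]
  constructor
  · rintro ⟨r', h⟩
    have := r'.2
    split_ifs at h <;> omega
  · rintro (h | ⟨h1, h2⟩)
    · refine ⟨⟨k - 1 - a.1, by omega⟩, ?_⟩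
      simp only
      rw [if_neg (by omega)]; omega
    · refine ⟨⟨k + c.1 - a.1, by omega⟩, ?_⟩
      simp only
      rw [if_pos (by omega)]; omega

theorem IsYoung.truncate {n k : ℕ} {μ : Finset (Box n k)} {h : Fin (n - k) → ℕ}
    (hμ : IsYoung μ h) {b : Box n k} (hb : b ∈ μ) :
    IsYoung (μ.filter fun q => ¬ readBefore b q)
      (fun c => if c < b.2 then h c else if c = b.2 then b.1.1 + 1 else 0) := by
  obtain ⟨r, c⟩ := b
  have hr := r.2
  have h1 : r.1 < h c := (hμ.mem (r, c)).1 hb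
  refine ⟨?_, ?_, ?_⟩
  · intro c₁ c₂ h12
    have h3 := hμ.anti c₁ c₂ h12
    have h4 : c₁ < c → h c ≤ h c₁ := fun h => hμ.anti _ _ h.le
    simp only [Fin.lt_def, Fin.le_def, Fin.ext_iff] at *
    split_ifs <;> omega
  · intro c'
    have := hμ.le c'
    simp only
    split_ifs <;> omega
  · rintro ⟨r', c'⟩
    rw [Finset.mem_filter, hμ.mem]
    simp only [readBefore, Fin.lt_def, Fin.ext_iff]
    have h2 : c'.1 = c.1 → h c' = h c := fun h => by rw [Fin.ext h]
    split_ifs <;> omega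

/-- The truncated diagram has its lower right end at `b = (r, c)`. Rows below `r` have length at
most `c` and the others at least `c + 1`, while columns up to `c` have height at least `r + 1` and
the later ones are empty. `IsColumnar` converts this into the values at most the label of `b`. -/
theorem truncated_inv_image {n k : ℕ} (hkn : k < n) {μ : Finset (Box n k)}
    {h : Fin (n - k) → ℕ} (hμ : IsYoung μ h) {b : Box n k} (hb : b ∈ μ) :
    (initial n ((boxLabel b).1 + 1)).image
      ⇑(wordProd (diagramWord (μ.filter fun q => ¬ readBefore b q)))⁻¹ = Aset b := by
  obtain ⟨h1, -⟩ := diagramWord_spec hkn _ _ _ (hμ.truncate hb) rfl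
  set π := wordProd (diagramWord (μ.filter fun q => ¬ readBefore b q))
  obtain ⟨r, c⟩ := b
  have hr := r.2
  have hc := c.2
  have hrc : r.1 < h c := (hμ.mem (r, c)).1 hb
  have hlab : (boxLabel (r, c) : Vtx n).1 = k - 1 - r.1 + c.1 := rfl
  ext a
  have hmem : a ∈ (initial n ((boxLabel (r, c) : Vtx n).1 + 1)).image ⇑π⁻¹ ↔
      (π a).1 < (boxLabel (r, c) : Vtx n).1 + 1 := by
    rw [Finset.mem_image]
    constructor
    · rintro ⟨d, hd, rfl⟩
      rw [perm_apply_inv]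
      simpa [mem_initial] using hd
    · intro hd
      exact ⟨π a, by simpa [mem_initial] using hd, perm_inv_apply π a⟩
  rw [hmem, hlab]
  simp only [mem_Aset]
  by_cases ha : a.1 < k
  · have h2 := h1.left a ha
    simp only at h2
    by_cases hlow : a.1 + 1 + r.1 < k
    · have h3 : (Finset.univ.filter fun c' : Fin (n - k) =>
          k ≤ a.1 + if c' < c then h c' else if c' = c then r.1 + 1 else 0).card ≤ c.1 := by
        rw [← card_filter_lt c]
        apply Finset.card_le_card
        intro c'
        simp only [Finset.mem_filter, Finset.mem_univ, true_and]
        split_ifs with h4 h5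
        · exact fun _ => h4
        · intro; omega
        · intro; omega
      omega
    · have h3 : c.1 + 1 ≤ (Finset.univ.filter fun c' : Fin (n - k) =>
          k ≤ a.1 + if c' < c then h c' else if c' = c then r.1 + 1 else 0).card := by
        rw [← Fin.card_Iic c]
        apply Finset.card_le_card
        intro c'
        simp only [Finset.mem_filter, Finset.mem_univ, true_and, Finset.mem_Iic]
        intro h4
        have := hμ.anti _ _ h4
        split_ifs with h5 h6
        · omega
        · omega
        · exact absurd (le_antisymm h4 (not_lt.1 h5)) h6
      omega
  · have h2 := h1.right a ⟨a.1 - k, by omega⟩ (by simp only; omega)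
    simp only [Fin.lt_def, Fin.ext_iff] at h2
    have h3 : a.1 - k < c.1 → h c ≤ h ⟨a.1 - k, by omega⟩ := fun h => hμ.anti _ _ h.le
    split_ifs at h2 <;> omega

/-! ### Comparison of the two regions -/

/-- Every path crosses the diagonal of a box at the time given by its label, shifted by one for the
indexing from zero. At that time the vertical and the horizontal condition for membership coincide.
-/
theorem mem_partSW {n k : ℕ} (hk : k < n) (I : Finset (Fin n)) (b : Box n k) :
    b ∈ partSW k I ↔ b.1.1 < vert I ((rotLabel b).1 + 1) := by
  obtain ⟨r, c⟩ := b
  have hr := r.2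
  have hc := c.2
  have hlab : (rotLabel (r, c) : Vtx n).1 + 1 + c.1 = r.1 + (n - k) := by
    simp only [rotLabel, boxLabel, Fin.val_rev]; omega
  have hlt := (rotLabel (r, c) : Vtx n).2
  have h1 := vert_add_hor I (p := (rotLabel (r, c) : Vtx n).1 + 1) (by omega)
  simp only [partSW, Finset.mem_filter, Finset.mem_univ, true_and]
  constructor
  · rintro ⟨p, hp1, hp2⟩
    rcases le_total p.1 ((rotLabel (r, c) : Vtx n).1 + 1) with h | h
    · have := vert_mono I h
      omega
    · have := hor_mono I h
      omega
  · intro h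
    exact ⟨⟨(rotLabel (r, c) : Vtx n).1 + 1, by omega⟩, h, by simp only; omega⟩

theorem mem_image_inv {n : ℕ} {I : Finset (Fin n)} {v : Equiv.Perm (Fin n)} {q : Fin n} :
    q ∈ I.image ⇑v⁻¹ ↔ v q ∈ I := by
  rw [Finset.mem_image]
  constructor
  · rintro ⟨d, hd, rfl⟩
    rwa [perm_apply_inv]
  · intro hd
    exact ⟨_, hd, perm_inv_apply v q⟩

theorem IsHeight.le_self {n m : ℕ} {g : ℕ → ℕ} (hg : IsHeight n m g) (p : ℕ) : g p ≤ p := by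
  induction p with
  | zero => exact hg.zero.le
  | succ p ih => have := hg.step p; omega

theorem boxLabel_val {n k : ℕ} (b : Box n k) : (boxLabel b).1 + 1 + b.1.1 = k + b.2.1 := by
  have := b.1.2
  simp only [boxLabel]; omega

/-- The indicator functions of the four sets satisfy the same relation pointwise, and `v⁻¹`
transports it. -/
theorem vert_sum_eq {n k : ℕ} (b : Box n k) (v : Equiv.Perm (Fin n)) (p : ℕ) :
    vert ((initial n ((boxLabel b).1 + 1)).image ⇑v⁻¹) p + vert ((Jset b).image ⇑v⁻¹) p =
      vert ((initial n k).image ⇑v⁻¹) p + vert ((Aset b).image ⇑v⁻¹) p := by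
  have hb := boxLabel_val b
  have hr := b.1.2
  induction p with
  | zero => simp only [vert_zero]
  | succ p ih =>
    by_cases hp : p < n
    · rw [vert_succ _ ⟨p, hp⟩, vert_succ _ ⟨p, hp⟩, vert_succ _ ⟨p, hp⟩, vert_succ _ ⟨p, hp⟩]
      simp only [mem_image_inv, mem_Jset, mem_initial, mem_Aset]
      split_ifs <;> omega
    · rw [vert_of_le (p := p + 1) _ (by omega), vert_of_le (p := p + 1) _ (by omega),
        vert_of_le (p := p + 1) _ (by omega), vert_of_le (p := p + 1) _ (by omega),
        ← vert_of_le (p := p) _ (by omega), ← vert_of_le (p := p) _ (by omega),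
        ← vert_of_le (p := p) _ (by omega), ← vert_of_le (p := p) _ (by omega), ih]

/-- The conclusion says that the diagonal at time `p` is empty. If `v p` is in the lower block, all
smaller values are taken after `p`, so the first path has no vertical step yet. Otherwise the
elements of `J(b)` outside `[k]` exceed `v p` and are taken before `p`; comparing the steps that
remain gives the inequality for the other pair of paths, and `vert_sum_eq` transfers it. -/
theorem vert_le_of_step_ne {n k : ℕ} (hkn : k < n) (b : Box n k) {v : Equiv.Perm (Fin n)}
    (hv : v ∈ WKmax n k) (hcard : (Jset b).card = k) (p : Fin n)
    (hp : ¬ ((v p).1 < (boxLabel b).1 + 1 ↔ (v p).1 < k)) :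
    vert ((initial n ((boxLabel b).1 + 1)).image ⇑v⁻¹) p.1 ≤
      vert ((Aset b).image ⇑v⁻¹) p.1 := by
  have hb := boxLabel_val b
  have hr := b.1.2
  have hbefore : ∀ q : Fin n, v q < v p → ((v q).1 < k ↔ (v p).1 < k) → p < q := by
    intro q h1 h2
    have := WKmax_inv_lt hv h1 h2
    rwa [perm_inv_apply, perm_inv_apply] at this
  by_cases hvp : (v p).1 < k
  · apply Finset.card_le_card
    intro q
    simp only [Finset.mem_filter, mem_image_inv]
    rintro ⟨h1, h2⟩
    rw [mem_initial] at h1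
    have := hbefore q (by rw [Fin.lt_def]; omega) (by omega)
    rw [Fin.lt_def] at this
    omega
  · have hsum := vert_sum_eq b v p.1
    have key : vert ((initial n k).image ⇑v⁻¹) p.1 ≤ vert ((Jset b).image ⇑v⁻¹) p.1 := by
      have h1 : ∀ I : Finset (Fin n), vert (I.image ⇑v⁻¹) p.1 +
          ((I.image ⇑v⁻¹).filter fun i => ¬ i.1 < p.1).card = I.card := by
        intro I
        rw [vert, Finset.card_filter_add_card_filter_not,
          Finset.card_image_of_injective _ (v⁻¹).injective]
      have h2 := h1 (initial n k)
      have h3 := h1 (Jset b)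
      rw [card_initial hkn.le] at h2
      have h4 : (((Jset b).image ⇑v⁻¹).filter fun i => ¬ i.1 < p.1).card ≤
          (((initial n k).image ⇑v⁻¹).filter fun i => ¬ i.1 < p.1).card := by
        apply Finset.card_le_card
        intro q
        simp only [Finset.mem_filter, mem_image_inv, mem_Jset]
        rintro ⟨h5, h6⟩
        refine ⟨?_, h6⟩
        rw [mem_initial]
        by_contra h7
        have h8 := WKmax_inv_lt hv (a := v p) (b := v q) (by rw [Fin.lt_def]; omega) (by omega)
        rw [perm_inv_apply, perm_inv_apply, Fin.lt_def] at h8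
        omega
      omega
    omega

/-- The matching shifts each diagonal by the difference of the upper heights of the two regions. Two
neighbouring diagonals either have the same shift, or the first of them is empty and adjacency is
not an issue. -/
theorem hasCompositionDiagram_region {n k : ℕ} (hkn : k < n) (b : Box n k)
    {v : Equiv.Perm (Fin n)} (hv : v ∈ WKmax n k) (hcard : (Jset b).card = k)
    {N : ModuleCat.{0} (Preproj n)}
    (C : DiagramCoord (n := n) N
      (heightRegion (vert ((initial n ((boxLabel b).1 + 1)).image ⇑v⁻¹))
        (vert ((Aset b).image ⇑v⁻¹)))) :
    HasCompositionDiagram N (region k ((Jset b).image ⇑v⁻¹) ((initial n k).image ⇑v⁻¹)) := by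
  have hsum := vert_sum_eq b v
  have hstep' := vert_le_of_step_ne hkn b hv hcard
  have hvert := C.vertex_lt
  have hg2 : IsHeight n k (vert ((initial n k).image ⇑v⁻¹)) := by
    have := isHeight_vert ((initial n k).image ⇑v⁻¹)
    rwa [Finset.card_image_of_injective _ (v⁻¹).injective, card_initial hkn.le] at this
  have hf2 : IsHeight n k (vert ((Jset b).image ⇑v⁻¹)) := by
    have := isHeight_vert ((Jset b).image ⇑v⁻¹)
    rwa [Finset.card_image_of_injective _ (v⁻¹).injective, hcard] at this
  have hstep : ∀ p, p < n →
      vert ((initial n ((boxLabel b).1 + 1)).image ⇑v⁻¹) p ≤ vert ((Aset b).image ⇑v⁻¹) p ∨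
      vert ((initial n ((boxLabel b).1 + 1)).image ⇑v⁻¹) (p + 1) +
        vert ((initial n k).image ⇑v⁻¹) p =
      vert ((initial n ((boxLabel b).1 + 1)).image ⇑v⁻¹) p +
        vert ((initial n k).image ⇑v⁻¹) (p + 1) := by
    intro p hp
    by_cases h : (v ⟨p, hp⟩).1 < (boxLabel b).1 + 1 ↔ (v ⟨p, hp⟩).1 < k
    · right
      have h1 := vert_succ ((initial n ((boxLabel b).1 + 1)).image ⇑v⁻¹) ⟨p, hp⟩
      have h2 := vert_succ ((initial n k).image ⇑v⁻¹) ⟨p, hp⟩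
      simp only [mem_image_inv, mem_initial] at h1 h2
      rw [h1, h2]
      simp only [h]
      omega
    · exact Or.inl (hstep' ⟨p, hp⟩ h)
  have hmem : ∀ q : Box n k,
      q ∈ region k ((Jset b).image ⇑v⁻¹) ((initial n k).image ⇑v⁻¹) ↔
      vert ((Jset b).image ⇑v⁻¹) ((rotLabel q).1 + 1) ≤ q.1.1 ∧
        q.1.1 < vert ((initial n k).image ⇑v⁻¹) ((rotLabel q).1 + 1) := by
    intro q
    rw [region, Finset.mem_sdiff, mem_partSW hkn, mem_partSW hkn, not_lt, and_comm]
  generalize vert ((initial n ((boxLabel b).1 + 1)).image ⇑v⁻¹) = g₁ at *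
  generalize vert ((Aset b).image ⇑v⁻¹) = f₁ at *
  generalize vert ((initial n k).image ⇑v⁻¹) = g₂ at *
  generalize vert ((Jset b).image ⇑v⁻¹) = f₂ at *
  have hlab : ∀ q : Box n k, (rotLabel q).1 + 1 + q.2.1 = q.1.1 + (n - k) := by
    rintro ⟨r, c⟩
    have := r.2
    have := c.2
    simp only [rotLabel, boxLabel, Fin.val_rev]; omega
  have hrot : ∀ q : Box n k, (rotLabel q).1 + 1 < n := fun q => by
    have := (rotLabel q : Vtx n).2; omega
  refine C.hasCompositionDiagram _
    (fun q => ((rotLabel q).1, q.1.1 + g₁ ((rotLabel q).1 + 1) - g₂ ((rotLabel q).1 + 1)))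
    ⟨?_, ?_, ?_⟩ (fun _ _ => rfl) ?_ ?_
  · intro q hq
    rw [Finset.mem_coe, hmem] at hq
    have := hsum ((rotLabel q).1 + 1)
    simp only [heightRegion, Set.mem_ofPred_eq]
    omega
  · intro q hq q' hq' h
    rw [Finset.mem_coe, hmem] at hq hq'
    simp only [Prod.mk.injEq] at h
    obtain ⟨h1, h2⟩ := h
    have h3 := hlab q
    have h4 := hlab q'
    have h5 := hsum ((rotLabel q).1 + 1)
    rw [h1] at h2 h3 h5 hq
    have h6 : q.1.1 = q'.1.1 := by omega
    exact Prod.ext (Fin.ext h6) (Fin.ext (by omega))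
  · rintro ⟨l, t⟩ hlt
    have hl : l + 1 < n := hvert _ hlt
    simp only [heightRegion, Set.mem_ofPred_eq] at hlt
    have h1 := hsum (l + 1)
    have h2 := hg2.le_self (l + 1)
    have h3 := topHeight_le hf2 (l + 1)
    have h4 := hg2.top n le_rfl
    have h5 : g₂ (l + 1) ≤ g₂ n := monotone_nat_of_le_succ hg2.mono hl.le
    simp only [topHeight] at h3
    -- The row undoes the shift; the subtraction is not truncated, since `f₁ ≤ t` and `vert_sum_eq`
    -- give `g₁ ≤ t + g₂` on this diagonal. The column is the only one with label `l` in that row.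
    -- It exists since the row is at least `f₂ (l + 1)`, which `topHeight_le` bounds below, and less
    -- than `g₂ (l + 1) ≤ l + 1`.
    let q : Box n k := (⟨t + g₂ (l + 1) - g₁ (l + 1), by omega⟩,
      ⟨t + g₂ (l + 1) - g₁ (l + 1) + (n - k) - 1 - l, by omega⟩)
    have hq1 : q.1.1 = t + g₂ (l + 1) - g₁ (l + 1) := rfl
    have hq2 : q.2.1 = t + g₂ (l + 1) - g₁ (l + 1) + (n - k) - 1 - l := rfl
    have hq : (rotLabel q).1 = l := by
      have := hlab q
      omega
    refine ⟨q, ?_, ?_⟩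
    · rw [Finset.mem_coe, hmem, hq]
      omega
    · simp only [hq, Prod.mk.injEq, true_and]
      omega
  · intro q hq q' hq'
    rw [hmem] at hq hq'
    have h1 := hlab q
    have h2 := hlab q'
    have h3 := hsum ((rotLabel q).1 + 1)
    have h4 := hstep _ (hrot q)
    have h5 := hsum ((rotLabel q').1 + 1)
    simp only [Below, Prod.mk.injEq, Fin.ext_iff]
    constructor
    · rintro ⟨h6, h7⟩
      have h8 : (rotLabel q').1 = (rotLabel q).1 + 1 := by omega
      rw [h8] at hq' h5 ⊢
      omega
    · rintro ⟨h8, h9⟩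
      rw [h8] at hq' h5 h9 h2
      omega
  · intro q hq q' hq'
    rw [hmem] at hq hq'
    have h1 := hlab q
    have h2 := hlab q'
    have h3 := hsum ((rotLabel q').1 + 1)
    have h4 := hstep _ (hrot q')
    have h5 := hsum ((rotLabel q).1 + 1)
    simp only [RightOf, Prod.mk.injEq, Fin.ext_iff]
    constructor
    · rintro ⟨h6, h7⟩
      have h8 : (rotLabel q).1 = (rotLabel q').1 + 1 := by omega
      rw [h8] at hq h5 ⊢
      omega
    · rintro ⟨h8, h9⟩
      rw [h8] at hq h5 h9 h1
      omega

/-- The total count in `vert_sum_eq` for the identity permutation reduces this to the cardinality of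
`Aset b`. -/
theorem card_Jset {n k : ℕ} (hkn : k < n) (b : Box n k) : (Jset b).card = k := by
  have hb := boxLabel_val b
  have h1 : (Aset b).card = (boxLabel b).1 + 1 := by
    have h2 := b.1.2
    have h3 := b.2.2
    have : (Finset.univ.filter fun a : Fin n => a.1 < k - 1 - b.1.1).card = k - 1 - b.1.1 :=
      card_initial (by omega)
    have h4 : Aset b = (Finset.univ.filter fun a : Fin n => a.1 < k - 1 - b.1.1) ∪
        Finset.Icc ⟨k, hkn⟩ ⟨k + b.2.1, by omega⟩ := by
      ext a
      simp only [mem_Aset, Finset.mem_union, Finset.mem_filter, Finset.mem_univ, true_and,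
        Finset.mem_Icc, Fin.le_def]
      omega
    rw [h4, Finset.card_union_of_disjoint, this, Fin.card_Icc]
    · simp only; omega
    · rw [Finset.disjoint_left]
      intro a
      simp only [Finset.mem_filter, Finset.mem_univ, true_and, Finset.mem_Icc, Fin.le_def]
      omega
  have h2 := vert_sum_eq b 1 n
  have hlt := (boxLabel b).2
  simp only [inv_one, Equiv.Perm.coe_one, Finset.image_id, vert_of_le _ le_rfl, h1,
    card_initial hkn.le, card_initial (show (boxLabel b).1 + 1 ≤ n by omega)] at h2
  omega

/-- The coordinates on `ℰ†_{y⁻¹}(Soc_{z⁻¹}(Q_i))` when `z` is a reduced word with final part `y`. -/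
theorem nonempty_coord_edagWord_socWord {n : ℕ} (i : Vtx n) (x y : List (Vtx n))
    (h : Reduced (x ++ y)) :
    Nonempty (DiagramCoord (n := n)
      (EdagWord y.reverse (ModuleCat.of (Preproj n) (socWord (InjMod i) (x ++ y).reverse)))
      (heightRegion (vert ((initial n (i.1 + 1)).image ⇑(wordProd y)⁻¹))
        (vert ((initial n (i.1 + 1)).image ⇑(wordProd (x ++ y))⁻¹)))) ∧
      ∀ p, vert ((initial n (i.1 + 1)).image ⇑(wordProd (x ++ y))⁻¹) p ≤
        vert ((initial n (i.1 + 1)).image ⇑(wordProd y)⁻¹) p := by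
  have hi := i.2
  have hg : IsHeight n (i.1 + 1) (vert (initial n (i.1 + 1))) := by
    have := isHeight_vert (initial n (i.1 + 1))
    rwa [card_initial (by omega)] at this
  have htop : IsHeight n (i.1 + 1) (topHeight n (i.1 + 1)) :=
    isHeight_topHeight (by omega) (by omega)
  have hw := hg.greedyWord (x ++ y).reverse
  constructor
  · have C := (injCoord i).ofSocWord (x ++ y).reverse
    rw [injRect_eq (by omega), remaining_heightRegion hg htop, heightRegion_diff (topHeight_le hw)]
      at C
    have D := C.nonempty_edagWord (N := ModuleCat.of (Preproj n) (socWord (InjMod i) _)) y.reverse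
    -- Taking `Soc` made the path of the full word the lower boundary; applying `ℰ†` restarts from
    -- the path of `[i + 1]` and lowers the upper boundary only.
    rwa [remaining_heightRegion hg hw, greedyWord_vert_initial _ _ h,
      greedyWord_vert_initial _ _ h.of_append.2] at D
  · intro p
    rw [← greedyWord_vert_initial _ _ h, ← greedyWord_vert_initial _ _ h.of_append.2,
      -- The letters of `x` act first and cannot raise the path above that of the initial set. The
      -- letters of `y` act monotonically, so the comparison persists.
      List.reverse_append, greedyWord_append]
    refine greedyWord_mono (fun q => ?_) _ p
    rw [greedyWord_vert_initial _ _ h.of_append.1, vert_initial (by omega)]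
    refine le_min ((isHeight_vert _).le_self q) ((vert_le_card _ q).trans ?_)
    rw [Finset.card_image_of_injective _ (Equiv.injective _), card_initial (by omega)]

/-! ### Positions in `J` and the corresponding final parts of the word -/

theorem pds_drop_append {n : ℕ} {v : Equiv.Perm (Fin n)} {x y : List (Vtx n)}
    (hy : Reduced y) (hv : wordProd y = v) {m : ℕ} (hm : x.length ≤ m) :
    pds v ((x ++ y).drop m) = (x ++ y).drop m := by
  obtain ⟨t, rfl⟩ := Nat.exists_eq_add_of_le hm
  rw [List.drop_length_add_append]
  exact pds_suffix (y.take t) (y.drop t) (by rwa [List.take_append_drop])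
    (by rwa [List.take_append_drop])

/-- Every letter of the reduced word `y` of `v` is selected, so a skipped position lies to the left
of it. -/
theorem length_le_of_mem_indexJ {n : ℕ} {v : Equiv.Perm (Fin n)} {x y : List (Vtx n)}
    (hy : Reduced y) (hv : wordProd y = v) (j : Fin (x ++ y).length)
    (hj : j ∈ indexJ v (x ++ y)) : y.length ≤ j.1 := by
  by_contra hlt
  have hjl : j.1 < x.length + y.length := lt_of_lt_of_eq j.2 List.length_append
  have hrev : j.rev.1 = x.length + y.length - (j.1 + 1) := by
    have happ : (x ++ y).length = x.length + y.length := List.length_append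
    rw [Fin.val_rev]; omega
  have h1 : pds v ((x ++ y).drop j.rev.1) = pds v ((x ++ y).drop (j.rev.1 + 1)) := hj
  rw [pds_drop_append hy hv (by omega), pds_drop_append hy hv (by omega)] at h1
  have h2 := congrArg List.length h1
  simp only [List.length_drop, List.length_append] at h2
  omega

/-- The final parts of a word that starts with the word of a diagram. -/
theorem wPart_letter_diagramWord_append {n k : ℕ} {μ : Finset (Box n k)} {y : List (Vtx n)}
    {b : Box n k} {p : ℕ} (hb : (columnarBoxes μ)[p]? = some b)
    (j : Fin (diagramWord μ ++ y).length) (hj : j.1 = y.length + p) :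
    wPart (diagramWord μ ++ y) j = diagramWord (μ.filter fun q => ¬ readBefore b q) ++ y ∧
      letter (diagramWord μ ++ y) j = boxLabel b := by
  obtain ⟨hp, hpb⟩ := List.getElem?_eq_some_iff.1 hb
  have hlen : (diagramWord μ).length = (columnarBoxes μ).length := by simp [diagramWord]
  have hrev : j.rev.1 = (columnarBoxes μ).length - (p + 1) := by
    have happ : (diagramWord μ ++ y).length = (diagramWord μ).length + y.length :=
      List.length_append
    rw [Fin.val_rev]; omega
  constructor
  · rw [wPart, hrev, List.drop_append_of_le_length (by omega)]
    congr 1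
    rw [diagramWord, diagramWord, ← take_columnarBoxes hb, List.map_take, List.reverse_take,
      List.length_map]
  · rw [letter, List.get_eq_getElem]
    have : ∀ m (hm : m < (diagramWord μ ++ y).length), m = (columnarBoxes μ).length - (p + 1) →
        (diagramWord μ ++ y)[m] = boxLabel b := by
      intro m hm hme
      rw [List.getElem_append_left (by omega)]
      simp only [diagramWord, List.getElem_reverse, List.getElem_map, List.length_map]
      have : (columnarBoxes μ).length - 1 - m = p := by omega
      simp only [this, hpb]
    exact this _ _ hrev

end SkewSchubert

open SkewSchubert

/-- Let `1 < k < n`, `v ∈ W^K_max`, `w = xv` length-additive, and `ws` a standard reduced expression for `w`.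
For `j ∈ J`, let `b` be the box of the diagram of `x([k])` whose letter stands at position `j`.  Then
the path of `P_j = v⁻¹(J(b))` lies weakly above that of `v⁻¹([k])`, and the region of `r(D)` between them is the
composition diagram of `U_j`. -/
theorem mainTheorem6 (n k : ℕ) (hk : 1 < k) (hkn : k < n) (x v : Equiv.Perm (Fin n))
    (hv : v ∈ WKmax n k) (hlen : len (x * v) = len x + len v)
    (ws : List (Vtx n)) (hws : IsStandardExpression k x v ws)
    (j : Fin ws.length) (hj : j ∈ indexJ v ws) :
    ∃ (p : ℕ) (b : Box n k),
      (columnarBoxes (partNE k ((initial n k).image x)))[p]? = some b ∧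
      j.1 = len v + p ∧
      partSW k ((Jset b).image ⇑v⁻¹) ⊆ partSW k ((initial n k).image ⇑v⁻¹) ∧
      HasCompositionDiagram (moduleU v ws j)
        (region k ((Jset b).image ⇑v⁻¹) ((initial n k).image ⇑v⁻¹)) := by
  obtain ⟨wK, v', ks, hwK, rfl, hks, hws⟩ := hws
  obtain ⟨hy1, hy2⟩ := standard_factor hkn hwK hv hks
  rw [List.append_assoc] at hws
  -- From here on the chosen words for `w_K` and `v'` matter only through their concatenation, a
  -- reduced word for `v`.
  generalize ks ++ columnarWord' k v' = y at hws hy1 hy2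
  generalize wK * v' = v at *
  have hx := fun a b : Fin n => left_factor_lt (a := a) (b := b) hv hlen
  obtain ⟨hx1, hx2⟩ := columnarWord_spec hkn hx
  have hμ := isYoung_partNE hkn hx
  change ws = diagramWord (partNE k ((initial n k).image x)) ++ y at hws
  change wordProd (diagramWord (partNE k ((initial n k).image x))) = x at hx1
  change Reduced (diagramWord (partNE k ((initial n k).image x))) at hx2
  generalize partNE k ((initial n k).image x) = μ at *
  subst hws
  have hylen : y.length = len v := by rw [← hy1]; exact hy2
  have hjy := length_le_of_mem_indexJ hy2 hy1 j hj
  obtain ⟨p, hp⟩ := Nat.exists_eq_add_of_le hjy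
  have hpl : p < (columnarBoxes μ).length := by
    have h1 : j.1 < (diagramWord μ).length + y.length := lt_of_lt_of_eq j.2 List.length_append
    have h2 : (diagramWord μ).length = (columnarBoxes μ).length := by simp [diagramWord]
    omega
  obtain ⟨b, hb⟩ : ∃ b, (columnarBoxes μ)[p]? = some b := ⟨_, List.getElem?_eq_getElem hpl⟩
  have hbμ : b ∈ μ := mem_columnarBoxes.1 (List.mem_of_getElem? hb)
  obtain ⟨hpart, hletter⟩ := wPart_letter_diagramWord_append hb j hp
  have hred : Reduced (diagramWord (μ.filter fun q => ¬ readBefore b q) ++ y) := by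
    have hall : Reduced (diagramWord μ ++ y) := by
      rw [Reduced] at hx2 hy2 ⊢
      rw [List.length_append, wordProd_append, hx2, hy2, hx1, hy1, hlen]
    rw [← hpart, wPart]
    exact (Reduced.of_append (y := (diagramWord μ ++ y).take j.rev.1)
      (by rwa [List.take_append_drop])).2
  obtain ⟨⟨C⟩, hle⟩ := nonempty_coord_edagWord_socWord (boxLabel b) _ y hred
  have himage : (initial n ((boxLabel b).1 + 1)).image
      ⇑(wordProd (diagramWord (μ.filter fun q => ¬ readBefore b q) ++ y))⁻¹ =
      (Aset b).image ⇑v⁻¹ := by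
    rw [wordProd_append, mul_inv_rev, Equiv.Perm.coe_mul, ← Finset.image_image,
      truncated_inv_image hkn hμ hbμ, hy1]
  rw [himage, hy1] at C hle
  refine ⟨p, b, hb, by rw [hp, hylen], ?_, ?_⟩
  -- The upper and lower boundaries of the diagram of `U_j` are in the right order by `hle`, and
  -- `vert_sum_eq` carries this over to the paths of `P_j` and `v⁻¹([k])`.
  · intro q hq
    rw [mem_partSW hkn] at hq ⊢
    have h1 := hle ((rotLabel q).1 + 1)
    have h2 := vert_sum_eq b v ((rotLabel q).1 + 1)
    omega
  · rw [moduleU, moduleV, hletter, hpart, pds_append _ _ hy2 hy1]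
    exact hasCompositionDiagram_region hkn b hv (card_Jset hkn b) C
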